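/- Let $\Omega\subset\mathbb{C}$ be a bounded domain (non-empty, open, connected). For $z\in\Omega$ let $\delta(z)>0$ be the Euclidean distance from $z$ to $\partial\Omega$. For $z_0\in\Omega$ let $$G(z,z_0)=\sup\Big\{u(z)\;:\; u \text{ negative subharmonic on }\Omega,\ \limsup_{\zeta\to z_0}\big(u(\zeta)-\log|\zeta-z_0|\big)<\infty\Big\}$$ be the (negative) Green's function of $\Omega$ with pole $z_0$, and let $$c_\beta(z_0)=\lim_{z\to z_0}\exp\big(G(z,z_0)-\log|z-z_0|\big)$$ be the logarithmic capacity of $\Omega$ at $z_0$. Then for every $z\in\Omega$ the limit defining $c_\beta(z)$ exists and is finite, and $$c_\beta(z)\le \frac{1}{\delta(z)}.$$ Moreover, for each $z_0\in\Omega$, equality $c_\beta(z_0)=1/\delta(z_0)$ holds if and only if $\Omega$ is an open disk centred at $z_0$, that is, $\Omega=\{z\in\mathbb{C}:|z-z_0|<r\}$ for some $r>0$. -/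

import Mathlib

open MeasureTheory Filter Topology Set

noncomputable section

/-- The mean `(1 / 2π) ∫₀^{2π} u (c + r e^{iθ}) dθ` of an extended-real function over a circle,
as the mean of the positive part minus the mean of the negative part. For an upper semicontinuous
function with values in `[-∞, ∞)` on the circle the positive part has a finite mean, so that the
difference is never of the form `∞ - ∞`. -/
def circleMean (u : ℂ → EReal) (c : ℂ) (r : ℝ) : EReal :=
  ((⨍⁻ θ in Ioc (0 : ℝ) (2 * Real.pi), (u (circleMap c r θ)).toENNReal ∂volume : ENNReal) : EReal) -
    ((⨍⁻ θ in Ioc (0 : ℝ) (2 * Real.pi), (-u (circleMap c r θ)).toENNReal ∂volume : ENNReal) : EReal)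

/-- `u : Ω → [-∞, ∞)` is subharmonic on the open set `Ω`: it is upper semicontinuous and
satisfies the local submean inequality. Values of `u` outside `Ω` play no role: `ρ` can always be
shrunk so that the disk of radius `ρ` about `w` lies in `Ω`. -/
structure SubharmonicOn (u : ℂ → EReal) (Ω : Set ℂ) : Prop where
  lt_top : ∀ w ∈ Ω, u w < ⊤
  upperSemicontinuousOn : UpperSemicontinuousOn u Ω
  le_circleMean : ∀ w ∈ Ω, ∃ ρ : ℝ, 0 < ρ ∧ ∀ r : ℝ, 0 < r → r < ρ → u w ≤ circleMean u w r

/-- The competitors for the Green's function of `Ω` with pole `z₀`: negative subharmonic functions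
`u` on `Ω` with `limsup_{z → z₀} (u z - log |z - z₀|) < ∞`. -/
def greenFamily (Ω : Set ℂ) (z₀ : ℂ) : Set (ℂ → EReal) :=
  {u | SubharmonicOn u Ω ∧ (∀ z ∈ Ω, u z < 0) ∧
    limsup (fun z : ℂ => u z - ((Real.log ‖z - z₀‖ : ℝ) : EReal)) (𝓝[≠] z₀) < ⊤}

/-- The (negative) Green's function `G(z, z₀)` of `Ω` with pole `z₀`, for `z ∈ Ω`. -/
def greenFunction (Ω : Set ℂ) (z z₀ : ℂ) : EReal :=
  ⨆ u ∈ greenFamily Ω z₀, u z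

/-- The quantity `exp (G(z, z₀) - log |z - z₀|)` whose limit as `z → z₀` is the logarithmic
capacity. -/
def greenQuotient (Ω : Set ℂ) (z₀ z : ℂ) : ENNReal :=
  EReal.exp (greenFunction Ω z z₀ - ((Real.log ‖z - z₀‖ : ℝ) : EReal))

/-- The logarithmic capacity `c_β(z₀) = lim_{z → z₀} exp (G(z, z₀) - log |z - z₀|)` of `Ω` at
`z₀`. -/
def logCapacity (Ω : Set ℂ) (z₀ : ℂ) : ℝ :=
  (limUnder (𝓝[≠] z₀) (greenQuotient Ω z₀)).toReal

/-- The Euclidean distance from `z` to the boundary of `Ω`. -/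
def boundaryDist (Ω : Set ℂ) (z : ℂ) : ℝ :=
  Metric.infDist z (frontier Ω)

end

/-!
Fix a pole `c ∈ Ω` and a radius `r` with `closedBall c r ⊆ Ω`. For a competitor `u` of the Green's
function that is bounded below on the circle `sphere c r`, let `P[u]` be the Poisson integral of the
restriction of `u` to that circle. Two facts carry the proof.

* `u z ≤ P[u] z + log (‖z - c‖ / r)` in the punctured disk (`le_poissonIntegral_add_log`). This
  follows from a comparison principle on annuli (`le_of_forall_le_circleMean`) if `u` is replaced on
  the circle by a continuous majorant, and then for `u` itself because an upper semicontinuous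
  function is a limit of continuous majorants.
* Replacing `u` in the disk by `P[u] z + log (‖z - c‖ / r)` gives another competitor
  (`poissonModification_mem_greenFamily`).

Hence near `c` the function `G(z, c) - log (‖z - c‖ / r)` is the supremum of the functions `P[u]`.
These are nonpositive, so Harnack's inequality at the centre compares `P[u] z` with the circle
average of `u`, with constants that tend to `1` as `z → c`, uniformly in `u`. Therefore the limit
exists, and `c_β(c) = exp A / r`, where `A ≤ 0` is the supremum of the circle averages of the
competitors (`tendsto_greenQuotient`, `logCapacity_eq`). Letting `r` increase to `δ(c)` gives
`c_β(c) ≤ 1 / δ(c)`.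

If `Ω` is not the disk `ball c δ`, then by connectedness it contains a point `q` of the circle
`sphere c δ`. All competitors are at most `log (‖z - c‖ / δ) < 0` inside the disk; comparison with a
multiple of a logarithm on an annulus around a point of the disk close to `q` carries a uniform
negative bound over to a neighbourhood of `q` (`exists_forall_le_neg_of_mem_sphere`). For `r` close
to `δ` an arc of fixed size lies in this neighbourhood, which bounds `A` away from `0` and makes the
inequality strict (`logCapacity_lt_one_div`). If `Ω` is a disk of radius `R` centred at `c`, the
competitor `log (‖z - c‖ / R)` gives equality.
-/

open Real Metric InnerProductSpace

/-! ### Means over circles -/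

theorem circleMean_mono {u v : ℂ → EReal} {c : ℂ} {r : ℝ}
    (h : ∀ z ∈ sphere c |r|, u z ≤ v z) : circleMean u c r ≤ circleMean v c r := by
  refine EReal.sub_le_sub ?_ ?_
  · rw [EReal.coe_ennreal_le_coe_ennreal_iff]
    exact laverage_mono_ae (.of_forall fun θ =>
      EReal.toENNReal_le_toENNReal (h _ (circleMap_mem_sphere' c r θ)))
  · rw [EReal.coe_ennreal_le_coe_ennreal_iff]
    exact laverage_mono_ae (.of_forall fun θ =>
      EReal.toENNReal_le_toENNReal (EReal.neg_le_neg_iff.2 (h _ (circleMap_mem_sphere' c r θ))))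

theorem circleMean_congr {u v : ℂ → EReal} {c : ℂ} {r : ℝ}
    (h : ∀ z ∈ sphere c |r|, u z = v z) : circleMean u c r = circleMean v c r :=
  le_antisymm (circleMean_mono fun z hz => (h z hz).le) (circleMean_mono fun z hz => (h z hz).ge)

theorem circleMean_coe {f : ℂ → ℝ} {c : ℂ} {r : ℝ} (hf : CircleIntegrable f c r) :
    circleMean (fun z => (f z : EReal)) c r = ((Real.circleAverage f c r : ℝ) : EReal) := by
  set μ : Measure ℝ := volume.restrict (Ioc 0 (2 * π)) with hμ
  have hfi : Integrable (fun θ => f (circleMap c r θ)) μ := by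
    have := intervalIntegrable_iff.1 hf
    rwa [uIoc_of_le two_pi_pos.le] at this
  have hfi' : Integrable (fun θ => f (circleMap c r θ)) ((μ univ)⁻¹ • μ) :=
    hfi.smul_measure (by simp [hμ, pi_pos])
  have key := integral_eq_lintegral_pos_part_sub_lintegral_neg_part hfi'
  have h1 : (∫⁻ θ, ENNReal.ofReal (f (circleMap c r θ)) ∂((μ univ)⁻¹ • μ)) ≠ ⊤ :=
    hfi'.lintegral_lt_top.ne
  have h2 : (∫⁻ θ, ENNReal.ofReal (-f (circleMap c r θ)) ∂((μ univ)⁻¹ • μ)) ≠ ⊤ :=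
    hfi'.neg.lintegral_lt_top.ne
  have havg : Real.circleAverage f c r = ∫ θ, f (circleMap c r θ) ∂((μ univ)⁻¹ • μ) := by
    rw [Real.circleAverage_def, intervalIntegral.integral_of_le two_pi_pos.le,
      integral_smul_measure]
    simp [hμ, pi_pos.le]
  rw [havg, key, EReal.coe_sub, EReal.coe_ennreal_toReal h1, EReal.coe_ennreal_toReal h2]
  rfl

theorem circleAverage_norm_sq (w : ℂ) (r : ℝ) :
    Real.circleAverage (fun z : ℂ => ‖z‖ ^ 2) w r = ‖w‖ ^ 2 + r ^ 2 := by
  have h : ∀ θ : ℝ, ‖circleMap w r θ‖ ^ 2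
      = (‖w‖ ^ 2 + r ^ 2) + (2 * r * w.re * cos θ + 2 * r * w.im * sin θ) := by
    intro θ
    rw [← Complex.normSq_eq_norm_sq, ← Complex.normSq_eq_norm_sq, Complex.normSq_apply,
      Complex.normSq_apply]
    simp only [circleMap, Complex.exp_mul_I, Complex.add_re, Complex.add_im, Complex.mul_re,
      Complex.mul_im, Complex.ofReal_re, Complex.ofReal_im, Complex.I_re, Complex.I_im,
      Complex.cos_ofReal_re, Complex.sin_ofReal_re, Complex.cos_ofReal_im, Complex.sin_ofReal_im]
    linear_combination r ^ 2 * (sin_sq_add_cos_sq θ)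
  rw [Real.circleAverage_def]
  simp_rw [h]
  rw [intervalIntegral.integral_add (by simp) (by apply Continuous.intervalIntegrable; fun_prop),
    intervalIntegral.integral_add (by apply Continuous.intervalIntegrable; fun_prop)
      (by apply Continuous.intervalIntegrable; fun_prop)]
  simp
  field_simp

/-! ### The comparison principle -/

/-- **Comparison principle.** An upper semicontinuous `u` lies below a continuous `h` on a compact
set if, at each point where it does not, `u` satisfies the submean inequality and `h` the
supermean inequality over at least one circle contained in the set. -/
theorem le_of_forall_le_circleMean {K : Set ℂ} (hK : IsCompact K) {u : ℂ → EReal} {h : ℂ → ℝ}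
    (hu : UpperSemicontinuousOn u K) (hutop : ∀ z ∈ K, u z < ⊤) (hh : ContinuousOn h K)
    (H : ∀ w ∈ K, u w ≤ h w ∨ ∃ r > 0, sphere w r ⊆ K ∧ u w ≤ circleMean u w r ∧
      Real.circleAverage h w r ≤ h w) :
    ∀ z ∈ K, u z ≤ h z := by
  intro z₁ hz₁
  by_contra! hlt
  -- The perturbation `ε ‖z‖ ^ 2` makes the submean inequality strict, so that `u - h + ε ‖z‖ ^ 2`
  -- cannot attain its maximum at a point of the second kind.
  obtain ⟨B, hB⟩ := hK.exists_bound_of_continuousOn (f := fun z : ℂ => ‖z‖ ^ 2) (by fun_prop)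
  have hB0 : 0 ≤ B := (norm_nonneg _).trans (hB z₁ hz₁)
  replace hB : ∀ z ∈ K, ‖z‖ ^ 2 ≤ B := fun z hz => (le_abs_self _).trans (hB z hz)
  obtain ⟨a, ha⟩ : ∃ a : ℝ, u z₁ = a :=
    ⟨(u z₁).toReal, (EReal.coe_toReal (hutop _ hz₁).ne (bot_le.trans_lt hlt).ne').symm⟩
  rw [ha, EReal.coe_lt_coe_iff] at hlt
  set ε := (a - h z₁) / (2 * (B + 1)) with hε
  have hε0 : 0 < ε := div_pos (by linarith) (by linarith)
  have hεB : ε * B < a - h z₁ := by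
    have : ε * (2 * (B + 1)) = a - h z₁ := by rw [hε]; field_simp
    nlinarith
  have hs : UpperSemicontinuousOn (fun z => u z + ((ε * ‖z‖ ^ 2 - h z : ℝ) : EReal)) K := by
    refine hu.add' ?_ ?_
    · refine ContinuousOn.upperSemicontinuousOn ?_
      exact continuous_coe_real_ereal.comp_continuousOn (by fun_prop)
    · intro x _
      exact EReal.continuousAt_add (.inr (EReal.coe_ne_bot _)) (.inr (EReal.coe_ne_top _))
  obtain ⟨w, hw, hmax⟩ := hs.exists_isMaxOn ⟨z₁, hz₁⟩ hK
  have hmax' : ∀ z ∈ K, u z + ((ε * ‖z‖ ^ 2 - h z : ℝ) : EReal)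
      ≤ u w + ((ε * ‖w‖ ^ 2 - h w : ℝ) : EReal) := fun z hz => hmax hz
  obtain ⟨b, hb⟩ : ∃ b : ℝ, u w = b := by
    refine ⟨(u w).toReal, (EReal.coe_toReal (hutop _ hw).ne fun hbot => ?_).symm⟩
    have := hmax' z₁ hz₁
    rw [hbot, EReal.bot_add, ha, ← EReal.coe_add, le_bot_iff] at this
    exact EReal.coe_ne_bot _ this
  have h1 := hmax' z₁ hz₁
  rw [ha, hb, ← EReal.coe_add, ← EReal.coe_add, EReal.coe_le_coe_iff] at h1
  have hwB := hB w hw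
  have hbh : h w < b := by nlinarith [sq_nonneg ‖z₁‖]
  rcases H w hw with hle | ⟨r, hr, hsub, hmean, havg⟩
  · rw [hb, EReal.coe_le_coe_iff] at hle
    linarith
  · have hint : CircleIntegrable h w r := (hh.mono hsub).circleIntegrable hr.le
    have hint2 : CircleIntegrable (fun z : ℂ => ε * ‖z‖ ^ 2) w r :=
      ContinuousOn.circleIntegrable hr.le (by fun_prop)
    have hint3 : CircleIntegrable (fun _ : ℂ => b + ε * ‖w‖ ^ 2 - h w) w r :=
      circleIntegrable_const _ _ _
    have hle : u w ≤ circleMean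
        (fun z => ((h z - ε * ‖z‖ ^ 2 + (b + ε * ‖w‖ ^ 2 - h w) : ℝ) : EReal)) w r := by
      refine hmean.trans (circleMean_mono fun z hz => ?_)
      rw [abs_of_pos hr] at hz
      have h2 := hmax' z (hsub hz)
      by_cases hbot : u z = ⊥
      · simp [hbot]
      obtain ⟨d, hd⟩ : ∃ d : ℝ, u z = d :=
        ⟨(u z).toReal, (EReal.coe_toReal (hutop _ (hsub hz)).ne hbot).symm⟩
      rw [hd, hb, ← EReal.coe_add, ← EReal.coe_add, EReal.coe_le_coe_iff] at h2
      rw [hd, EReal.coe_le_coe_iff]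
      linarith
    rw [circleMean_coe (f := fun z => h z - ε * ‖z‖ ^ 2 + (b + ε * ‖w‖ ^ 2 - h w))
      ((hint.sub hint2).add hint3), 
      Real.circleAverage_fun_add (f₁ := fun z => h z - ε * ‖z‖ ^ 2) (hint.sub hint2) hint3,
      Real.circleAverage_fun_sub hint hint2, Real.circleAverage_const] at hle
    have : Real.circleAverage (fun z : ℂ => ε * ‖z‖ ^ 2) w r = ε * (‖w‖ ^ 2 + r ^ 2) := by
      rw [← circleAverage_norm_sq]
      exact Real.circleAverage_fun_smul (a := ε)
    rw [this, hb, EReal.coe_le_coe_iff] at hle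
    nlinarith [mul_pos hε0 (pow_pos hr 2)]

/-! ### Poisson integrals -/

/-- The Poisson integral at `z`, over the circle of radius `r` about `c`, of a function `φ` given on
that circle. It is meaningful for `z ∈ ball c r` and circle integrable `φ`. -/
noncomputable def poissonIntegral (φ : ℂ → ℝ) (c : ℂ) (r : ℝ) (z : ℂ) : ℝ :=
  Real.circleAverage (fun ζ => poissonKernel c z ζ * φ ζ) c r

section Poisson

variable {φ ψ : ℂ → ℝ} {c z ζ : ℂ} {r : ℝ}

theorem poissonKernel_le (hz : z ∈ ball c r) (hζ : ζ ∈ sphere c r) :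
    poissonKernel c z ζ ≤ (r + ‖z - c‖) / (r - ‖z - c‖) := by
  rw [poissonKernel_eq_re_herglotzRieszKernel]
  exact re_herglotzRieszKernel_le hζ hz

theorem le_poissonKernel (hz : z ∈ ball c r) (hζ : ζ ∈ sphere c r) :
    (r - ‖z - c‖) / (r + ‖z - c‖) ≤ poissonKernel c z ζ := by
  rw [poissonKernel_eq_re_herglotzRieszKernel]
  exact le_re_herglotzRieszKernel hζ hz

theorem poissonKernel_nonneg (hz : z ∈ ball c r) (hζ : ζ ∈ sphere c r) :
    0 ≤ poissonKernel c z ζ := by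
  refine le_trans ?_ (le_poissonKernel hz hζ)
  have h1 := mem_ball_iff_norm.1 hz
  have h2 := norm_nonneg (z - c)
  exact div_nonneg (by linarith) (by linarith)

theorem continuousOn_poissonKernel (hz : z ∈ ball c r) :
    ContinuousOn (poissonKernel c z) (sphere c |r|) := by
  rw [poissonKernel_eq_re_herglotzRieszKernel]
  exact Complex.continuous_re.comp_continuousOn (continuousOn_herglotzRieszKernel_sphere hz)

theorem CircleIntegrable.poissonKernel_mul (hφ : CircleIntegrable φ c r) (hz : z ∈ ball c r) :
    CircleIntegrable (fun ζ => poissonKernel c z ζ * φ ζ) c r :=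
  hφ.continuousOn_mul (continuousOn_poissonKernel hz)

theorem poissonIntegral_const (hz : z ∈ ball c r) (a : ℝ) :
    poissonIntegral (fun _ => a) c r z = a := by
  have h : HarmonicContOnCl (fun _ : ℂ => a) (ball c r) :=
    ⟨harmonicOnNhd_const a, continuousOn_const⟩
  have := h.circleAverage_poissonKernel_smul hz
  exact this

theorem poissonIntegral_neg : poissonIntegral (-φ) c r z = -poissonIntegral φ c r z := by
  have := Real.circleAverage_smul (a := (-1 : ℝ)) (f := fun ζ => poissonKernel c z ζ * φ ζ)
    (c := c) (R := r)
  rw [neg_one_smul, neg_one_smul] at this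
  rw [poissonIntegral, poissonIntegral, ← this]
  congr 1
  ext ζ
  simp

theorem poissonIntegral_mono (hr : 0 ≤ r) (hφ : CircleIntegrable φ c r)
    (hψ : CircleIntegrable ψ c r) (hz : z ∈ ball c r) (h : ∀ ζ ∈ sphere c r, φ ζ ≤ ψ ζ) :
    poissonIntegral φ c r z ≤ poissonIntegral ψ c r z := by
  refine Real.circleAverage_mono (hφ.poissonKernel_mul hz) (hψ.poissonKernel_mul hz) fun ζ hζ => ?_
  rw [abs_of_nonneg hr] at hζ
  exact mul_le_mul_of_nonneg_left (h ζ hζ) (poissonKernel_nonneg hz hζ)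

/-- Upper half of Harnack's inequality at the centre, for nonpositive boundary values. -/
theorem poissonIntegral_le_of_nonpos (hr : 0 ≤ r) (hφ : CircleIntegrable φ c r) (hz : z ∈ ball c r)
    (h : ∀ ζ ∈ sphere c r, φ ζ ≤ 0) :
    poissonIntegral φ c r z ≤ (r - ‖z - c‖) / (r + ‖z - c‖) * Real.circleAverage φ c r := by
  rw [← smul_eq_mul, ← Real.circleAverage_fun_smul]
  refine Real.circleAverage_mono (hφ.poissonKernel_mul hz) hφ.const_smul fun ζ hζ => ?_
  rw [abs_of_nonneg hr] at hζ
  exact mul_le_mul_of_nonpos_right (le_poissonKernel hz hζ) (h ζ hζ)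

/-- Lower half of Harnack's inequality at the centre, for nonpositive boundary values. -/
theorem le_poissonIntegral_of_nonpos (hr : 0 ≤ r) (hφ : CircleIntegrable φ c r) (hz : z ∈ ball c r)
    (h : ∀ ζ ∈ sphere c r, φ ζ ≤ 0) :
    (r + ‖z - c‖) / (r - ‖z - c‖) * Real.circleAverage φ c r ≤ poissonIntegral φ c r z := by
  rw [← smul_eq_mul, ← Real.circleAverage_fun_smul]
  refine Real.circleAverage_mono hφ.const_smul (hφ.poissonKernel_mul hz) fun ζ hζ => ?_
  rw [abs_of_nonneg hr] at hζ
  exact mul_le_mul_of_nonpos_right (poissonKernel_le hz hζ) (h ζ hζ)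

theorem harmonicOnNhd_poissonIntegral (hφ : CircleIntegrable φ c r) :
    HarmonicOnNhd (poissonIntegral φ c r) (ball c r) := by
  set g : ℂ → ℝ := fun ζ => φ (ζ + c) with hg
  have hgi : CircleIntegrable g 0 r := by
    rw [CircleIntegrable] at hφ ⊢
    convert hφ using 3
    simp [circleMap, add_comm]
  have hgi' : CircleIntegrable (fun ζ => (g ζ : ℂ)) 0 r := by
    rw [CircleIntegrable, intervalIntegrable_iff] at hgi ⊢
    exact Complex.ofRealCLM.integrable_comp hgi
  intro z hz
  have hz0 : z - c ∈ ball (0 : ℂ) r := by simpa using mem_ball_iff_norm.1 hz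
  have han := analyticOnNhd_circleAverage_herglotzRieszKernel_smul hgi' (z - c) hz0
  have han' : AnalyticAt ℂ (fun w => Real.circleAverage
      (fun ζ => herglotzRieszKernel 0 (w - c) ζ • (g ζ : ℂ)) 0 r) z :=
    AnalyticAt.fun_comp (f := fun w => w - c) han (by fun_prop)
  refine (harmonicAt_congr_nhds ?_).1 han'.harmonicAt_re
  filter_upwards [isOpen_ball.mem_nhds hz] with w hw
  have hw0 : w - c ∈ ball (0 : ℂ) r := by simpa using mem_ball_iff_norm.1 hw
  rw [re_circleAverage_herglotzRieszKernel_smul hgi hw0, poissonIntegral,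
    ← Real.circleAverage_map_add_const (f := fun ζ => poissonKernel c w ζ * φ ζ) (c := c)]
  congr 1
  ext ζ
  rw [poissonKernel_eq_re_herglotzRieszKernel]
  simp [hg, herglotzRieszKernel_add_const]

/-- The upper limit of the Poisson integral at a boundary point is at most the upper limit of the
boundary values: away from `ζ₀` the kernel is bounded by a multiple of `r ^ 2 - ‖z - c‖ ^ 2`, which
tends to zero as `z → ζ₀`. -/
theorem eventually_poissonIntegral_lt (hr : 0 < r) (hφ : CircleIntegrable φ c r) {N : ℝ}
    (hN : ∀ ζ ∈ sphere c r, φ ζ ≤ N) {ζ₀ : ℂ} (hζ₀ : ζ₀ ∈ sphere c r) {b b' : ℝ}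
    (hb : ∀ᶠ ζ in 𝓝[sphere c r] ζ₀, φ ζ ≤ b) (hbb : b < b') :
    ∀ᶠ z in 𝓝[ball c r] ζ₀, poissonIntegral φ c r z < b' := by
  obtain ⟨d, hd, hd'⟩ := Metric.mem_nhdsWithin_iff.1 hb
  set M := max (N - b) 0 with hM
  have hM0 : 0 ≤ M := le_max_right _ _
  have hlim : Tendsto (fun z => b + (r ^ 2 - ‖z - c‖ ^ 2) / (d / 2) ^ 2 * M) (𝓝[ball c r] ζ₀)
      (𝓝 b) := by
    have : ContinuousAt (fun z => b + (r ^ 2 - ‖z - c‖ ^ 2) / (d / 2) ^ 2 * M) ζ₀ := by fun_prop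
    have h2 := this.tendsto.mono_left (nhdsWithin_le_nhds (s := ball c r))
    simpa [mem_sphere_iff_norm.1 hζ₀] using h2
  filter_upwards [hlim.eventually_lt_const hbb, self_mem_nhdsWithin,
    nhdsWithin_le_nhds (ball_mem_nhds ζ₀ (half_pos hd))] with z hz1 hz hz2
  refine lt_of_le_of_lt ?_ hz1
  have hρ : 0 ≤ (r ^ 2 - ‖z - c‖ ^ 2) := by
    have := mem_ball_iff_norm.1 hz
    nlinarith [norm_nonneg (z - c)]
  have hci : CircleIntegrable (fun _ : ℂ => b) c r := circleIntegrable_const _ _ _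
  calc poissonIntegral φ c r z
      ≤ Real.circleAverage (fun ζ => poissonKernel c z ζ * b
          + (r ^ 2 - ‖z - c‖ ^ 2) / (d / 2) ^ 2 * M) c r := by
        refine Real.circleAverage_mono (hφ.poissonKernel_mul hz)
          ((hci.poissonKernel_mul hz).add (circleIntegrable_const _ _ _)) fun ζ hζ => ?_
        rw [abs_of_pos hr] at hζ
        have hK := poissonKernel_nonneg hz hζ
        by_cases hnear : ζ ∈ ball ζ₀ d
        · have h1 : φ ζ ≤ b := hd' ⟨hnear, hζ⟩
          have h2 : 0 ≤ (r ^ 2 - ‖z - c‖ ^ 2) / (d / 2) ^ 2 * M := by positivity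
          have := mul_le_mul_of_nonneg_left h1 hK
          show _ ≤ poissonKernel c z ζ * b + _
          linarith
        · have h1 : φ ζ ≤ b + M := by
            have := hN ζ hζ
            have := le_max_left (N - b) 0
            linarith
          have h2 : poissonKernel c z ζ ≤ (r ^ 2 - ‖z - c‖ ^ 2) / (d / 2) ^ 2 := by
            rw [poissonKernel_def, mem_sphere_iff_norm.1 hζ]
            have : d / 2 ≤ ‖ζ - c - (z - c)‖ := by
              rw [sub_sub_sub_cancel_right, ← dist_eq_norm]
              have := dist_triangle ζ z ζ₀
              rw [mem_ball, not_lt] at hnear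
              rw [mem_ball] at hz2
              linarith
            gcongr
          have := mul_le_mul_of_nonneg_left h1 hK
          have := mul_le_mul_of_nonneg_right h2 hM0
          show _ ≤ poissonKernel c z ζ * b + _
          linarith
    _ = b + (r ^ 2 - ‖z - c‖ ^ 2) / (d / 2) ^ 2 * M := by
        rw [Real.circleAverage_fun_add (hci.poissonKernel_mul hz) (circleIntegrable_const _ _ _),
          Real.circleAverage_const]
        congr 1
        exact poissonIntegral_const hz b

open Classical in
/-- For continuous boundary values the Poisson integral solves the Dirichlet problem: together with
its boundary values it is continuous on the closed disk. -/
theorem continuousOn_poissonIntegral_ite (hr : 0 < r) (hφ : Continuous φ) :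
    ContinuousOn (fun z => if z ∈ ball c r then poissonIntegral φ c r z else φ z)
      (closedBall c r) := by
  have key : ∀ {φ : ℂ → ℝ}, Continuous φ → ∀ ζ ∈ sphere c r, ∀ b, φ ζ < b →
      ∀ᶠ z in 𝓝[closedBall c r] ζ,
        (if z ∈ ball c r then poissonIntegral φ c r z else φ z) < b := by
    intro φ hφ ζ hζ b hb
    obtain ⟨b₁, hb₁, hb₁'⟩ := exists_between hb
    obtain ⟨N, hN⟩ := (isCompact_sphere c r).exists_bound_of_continuousOn hφ.continuousOn
    have h1 := eventually_poissonIntegral_lt hr (hφ.continuousOn.circleIntegrable hr.le)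
      (fun ζ hζ => (le_abs_self _).trans (hN ζ hζ)) hζ
      (nhdsWithin_le_nhds ((hφ.tendsto ζ).eventually_le_const hb₁)) hb₁'
    rw [eventually_nhdsWithin_iff] at h1
    filter_upwards [nhdsWithin_le_nhds h1,
      nhdsWithin_le_nhds ((hφ.tendsto ζ).eventually_lt_const hb)] with z hz1 hz2
    split_ifs with h
    · exact hz1 h
    · exact hz2
  intro z hz
  by_cases hzb : z ∈ ball c r
  · refine ContinuousAt.continuousWithinAt ?_
    refine ContinuousAt.congr ((harmonicOnNhd_poissonIntegral
      (hφ.continuousOn.circleIntegrable hr.le)).continuousOn.continuousAt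
      (isOpen_ball.mem_nhds hzb)) ?_
    filter_upwards [isOpen_ball.mem_nhds hzb] with w hw
    rw [if_pos hw]
  · have hzs : z ∈ sphere c r := by
      rw [mem_sphere]; rw [mem_closedBall] at hz; rw [mem_ball, not_lt] at hzb
      exact le_antisymm hz hzb
    rw [ContinuousWithinAt, if_neg hzb, tendsto_order]
    refine ⟨fun a ha => ?_, fun b hb => key hφ z hzs b hb⟩
    filter_upwards [key hφ.neg z hzs (-a) (by simpa using ha)] with w hw
    split_ifs at hw ⊢ with h
    · rw [poissonIntegral_neg] at hw; linarith
    · simpa using hw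

end Poisson

/-! ### Continuous majorants of upper semicontinuous functions -/

/-- An upper semicontinuous function that is bounded above is the pointwise limit of continuous
majorants with the same upper bound, namely of its sup-convolutions
`x ↦ ⨆ y, (φ y - n * dist x y)`. -/
theorem exists_seq_continuous_tendsto_of_usc {X : Type*} [PseudoMetricSpace X] {S : Set X}
    {φ : X → ℝ} (hS : S.Nonempty) {N : ℝ} (hN : ∀ x ∈ S, φ x ≤ N) (hφ : UpperSemicontinuousOn φ S) :
    ∃ f : ℕ → X → ℝ, (∀ n, Continuous (f n)) ∧ (∀ n, ∀ x ∈ S, φ x ≤ f n x) ∧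
      (∀ n, ∀ x, f n x ≤ N) ∧ ∀ x ∈ S, Tendsto (fun n => f n x) atTop (𝓝 (φ x)) := by
  have : Nonempty S := hS.to_subtype
  have hbd : ∀ (n : ℕ) (x : X), BddAbove (range fun y : S => φ y - n * dist x y) := by
    rintro n x
    refine ⟨N, ?_⟩
    rintro _ ⟨y, rfl⟩
    have := hN y y.2
    have : 0 ≤ n * dist x y := by positivity
    linarith
  have hge : ∀ (n : ℕ), ∀ x ∈ S, φ x ≤ ⨆ y : S, (φ y - n * dist x y) := by
    intro n x hx
    simpa using le_ciSup (hbd n x) ⟨x, hx⟩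
  refine ⟨fun n x => ⨆ y : S, (φ y - n * dist x y), fun n => ?_, hge, fun n x => ?_, fun x hx => ?_⟩
  · refine (LipschitzWith.of_le_add_mul (n : NNReal) fun x x' => ciSup_le fun y => ?_).continuous
    have h1 := le_ciSup (hbd n x') y
    have h2 := mul_le_mul_of_nonneg_left (dist_triangle x' x y) (Nat.cast_nonneg (α := ℝ) n)
    rw [dist_comm x' x] at h2
    simp only [NNReal.coe_natCast]
    linarith
  · refine ciSup_le fun y => ?_
    have := hN y y.2
    have : 0 ≤ n * dist x y := by positivity
    linarith
  · rw [tendsto_order]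
    refine ⟨fun a ha => .of_forall fun n => ha.trans_le (hge n x hx), fun b hb => ?_⟩
    obtain ⟨b₁, hb₁, hb₁'⟩ := exists_between hb
    obtain ⟨d, hd, hd'⟩ := Metric.mem_nhdsWithin_iff.1 (hφ x hx b₁ hb₁)
    filter_upwards [eventually_ge_atTop ⌈(N - b₁) / d⌉₊] with n hn
    refine lt_of_le_of_lt (ciSup_le fun y => ?_) hb₁'
    by_cases hy : (y : X) ∈ ball x d
    · have h1 : φ y < b₁ := hd' ⟨hy, y.2⟩
      have : 0 ≤ n * dist x y := by positivity
      linarith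
    · rw [mem_ball, not_lt, dist_comm] at hy
      have h1 := hN y y.2
      have h2 : (N - b₁) / d ≤ n := Nat.ceil_le.1 hn
      rw [div_le_iff₀ hd] at h2
      have := mul_le_mul_of_nonneg_left hy (Nat.cast_nonneg (α := ℝ) n)
      linarith

/-! ### Subharmonic functions and their Poisson integrals -/

theorem exists_forall_circleAverage_eq {f : ℂ → ℝ} {U : Set ℂ} (hU : IsOpen U)
    (hf : HarmonicOnNhd f U) {w : ℂ} (hw : w ∈ U) :
    ∃ ρ > 0, ∀ s : ℝ, 0 < s → s < ρ → closedBall w s ⊆ U ∧ Real.circleAverage f w s = f w := by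
  obtain ⟨ρ, hρ, hsub⟩ := Metric.isOpen_iff.1 hU w hw
  refine ⟨ρ, hρ, fun s hs hsρ => ?_⟩
  have h1 : closedBall w s ⊆ U := (closedBall_subset_ball hsρ).trans hsub
  refine ⟨h1, InnerProductSpace.HarmonicOnNhd.circleAverage_eq (hf.mono ?_)⟩
  rwa [abs_of_pos hs]

theorem harmonicAt_log_norm_div {c z : ℂ} {r : ℝ} (hr : r ≠ 0) (hz : z ≠ c) :
    HarmonicAt (fun w => log (‖w - c‖ / r)) z := by
  have h := AnalyticAt.harmonicAt_log_norm (f := fun w => (w - c) / (r : ℂ)) (z := z)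
    (by fun_prop (disch := simpa using hr))
    (div_ne_zero (sub_ne_zero.2 hz) (by simpa using hr))
  refine (harmonicAt_congr_nhds (.of_forall fun w => ?_)).1 h
  simp only [norm_div, Complex.norm_real, Real.norm_eq_abs]
  rw [← log_abs, abs_div, abs_abs, abs_of_nonneg (norm_nonneg _), ← log_abs (‖w - c‖ / r), abs_div,
    abs_of_nonneg (norm_nonneg _)]

theorem log_norm_div_eq {c z : ℂ} {r : ℝ} (hr : 0 < r) (hz : z ≠ c) :
    log (‖z - c‖ / r) = log ‖z - c‖ - log r :=
  log_div (norm_ne_zero_iff.2 (sub_ne_zero.2 hz)) hr.ne'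

/-- The comparison is with `P[φ] + (1 - ε) log (‖z - c‖ / r)` on an annulus whose inner radius is so
small that the weaker logarithmic pole dominates `u` on the inner circle; then `ε → 0`. -/
theorem SubharmonicOn.le_poissonIntegral_add_log_of_continuous {u : ℂ → EReal} {Ω : Set ℂ}
    {c : ℂ} {r M : ℝ} (hu : SubharmonicOn u Ω) (hr : 0 < r) (hsub : closedBall c r ⊆ Ω)
    (hM : ∀ᶠ z in 𝓝[≠] c, u z ≤ ((log ‖z - c‖ + M : ℝ) : EReal))
    {φ : ℂ → ℝ} (hφ : Continuous φ) (huφ : ∀ ζ ∈ sphere c r, u ζ ≤ φ ζ)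
    {z : ℂ} (hz : z ∈ ball c r) (hzc : z ≠ c) :
    u z ≤ ((poissonIntegral φ c r z + log (‖z - c‖ / r) : ℝ) : EReal) := by
  classical
  have hφi : CircleIntegrable φ c r := hφ.continuousOn.circleIntegrable hr.le
  set P : ℂ → ℝ := fun z => if z ∈ ball c r then poissonIntegral φ c r z else φ z with hP
  have hPc : ContinuousOn P (closedBall c r) := continuousOn_poissonIntegral_ite hr hφ
  obtain ⟨B, hB⟩ := (isCompact_closedBall c r).exists_bound_of_continuousOn hPc
  have key : ∀ ε : ℝ, 0 < ε → ε < 1 →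
      u z ≤ ((poissonIntegral φ c r z + (1 - ε) * log (‖z - c‖ / r) : ℝ) : EReal) := by
    intro ε hε hε1
    obtain ⟨d, hd, hd'⟩ := Metric.mem_nhdsWithin_iff.1 hM
    have hzpos : 0 < ‖z - c‖ := norm_pos_iff.2 (sub_ne_zero.2 hzc)
    -- The bound on `log η` is what makes the comparison function exceed `log η + M` when `‖w - c‖ = η`.
    obtain ⟨η, hη0, hηz, hηd, hηlog⟩ : ∃ η : ℝ, 0 < η ∧ η < ‖z - c‖ ∧ η < d ∧
        log η ≤ (-B - M - (1 - ε) * log r) / ε := by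
      have h1 := tendsto_log_nhdsGT_zero.eventually_le_atBot ((-B - M - (1 - ε) * log r) / ε)
      have h2 : ∀ᶠ η in 𝓝[>] (0 : ℝ), η < ‖z - c‖ := nhdsWithin_le_nhds (gt_mem_nhds hzpos)
      have h3 : ∀ᶠ η in 𝓝[>] (0 : ℝ), η < d := nhdsWithin_le_nhds (gt_mem_nhds hd)
      obtain ⟨η, h1, h2, h3, h4⟩ := (h1.and (h2.and (h3.and self_mem_nhdsWithin))).exists
      exact ⟨η, h4, h2, h3, h1⟩
    rw [le_div_iff₀ hε] at hηlog
    set K : Set ℂ := closedBall c r \ ball c η with hK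
    set h : ℂ → ℝ := fun z => P z + (1 - ε) * log (‖z - c‖ / r) with hh
    have hKne : ∀ w, w ∉ ball c η → w ≠ c := by
      rintro w hw rfl
      exact hw (mem_ball_self hη0)
    set U : Set ℂ := ball c r ∩ (closedBall c η)ᶜ with hU
    have hUo : IsOpen U := isOpen_ball.inter isClosed_closedBall.isOpen_compl
    have hUK : U ⊆ K := fun w hw =>
      ⟨ball_subset_closedBall hw.1, fun h => hw.2 (ball_subset_closedBall h)⟩
    have hharm : HarmonicOnNhd h U := by
      intro w hw
      have h1 := harmonicOnNhd_poissonIntegral hφi w hw.1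
      have h2 := (harmonicAt_log_norm_div hr.ne' (hKne w (hUK hw).2)).const_smul (c := 1 - ε)
      refine (harmonicAt_congr_nhds ?_).1 (h1.add h2)
      filter_upwards [isOpen_ball.mem_nhds hw.1] with x hx
      simp only [hh, hP, if_pos hx]
      rfl
    have hres := le_of_forall_le_circleMean (K := K) (u := u) (h := h)
      ((isCompact_closedBall c r).diff isOpen_ball)
      (hu.upperSemicontinuousOn.mono (sdiff_subset.trans hsub))
      (fun w hw => hu.lt_top w (hsub hw.1)) ?_ ?_ z ?_
    · simpa only [hh, hP, if_pos hz] using hres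
    · refine (hPc.mono sdiff_subset).add (continuousOn_const.mul ?_)
      refine ContinuousOn.log (by fun_prop) fun w hw => ?_
      exact div_ne_zero (norm_ne_zero_iff.2 (sub_ne_zero.2 (hKne w hw.2))) hr.ne'
    · intro w hw
      by_cases hwr : w ∈ ball c r
      · by_cases hwη : w ∈ closedBall c η
        · left
          have hnorm : ‖w - c‖ = η := by
            rw [← mem_sphere_iff_norm, mem_sphere]
            have := hw.2
            rw [mem_ball, not_lt] at this
            exact le_antisymm hwη this
          have h1 : u w ≤ ((log ‖w - c‖ + M : ℝ) : EReal) :=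
            hd' ⟨by rwa [mem_ball_iff_norm, hnorm], hKne w hw.2⟩
          refine h1.trans (EReal.coe_le_coe_iff.2 ?_)
          have h2 := (abs_le.1 (hB w hw.1)).1
          simp only [hh]
          rw [log_norm_div_eq hr (hKne w hw.2), hnorm]
          linarith
        · right
          have hwU : w ∈ U := ⟨hwr, hwη⟩
          obtain ⟨ρ₁, hρ₁, h1⟩ := exists_forall_circleAverage_eq hUo hharm hwU
          obtain ⟨ρ₂, hρ₂, h2⟩ := hu.le_circleMean w (hsub hw.1)
          obtain ⟨s, hs, hs'⟩ := exists_between (lt_min hρ₁ hρ₂)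
          have h3 := h1 s hs (hs'.trans_le (min_le_left _ _))
          exact ⟨s, hs, sphere_subset_closedBall.trans (h3.1.trans hUK),
            h2 s hs (hs'.trans_le (min_le_right _ _)), h3.2.le⟩
      · left
        have hws : w ∈ sphere c r := by
          rw [mem_ball, not_lt] at hwr
          exact le_antisymm hw.1 hwr
        have : h w = φ w := by
          simp only [hh, hP, if_neg hwr]
          rw [mem_sphere_iff_norm.1 hws, div_self hr.ne', log_one, mul_zero, add_zero]
        rw [this]
        exact huφ w hws
    · refine ⟨ball_subset_closedBall hz, ?_⟩
      rw [mem_ball_iff_norm, not_lt]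
      exact hηz.le
  have hlim : Tendsto (fun ε : ℝ =>
      ((poissonIntegral φ c r z + (1 - ε) * log (‖z - c‖ / r) : ℝ) : EReal)) (𝓝[>] 0)
      (𝓝 ((poissonIntegral φ c r z + log (‖z - c‖ / r) : ℝ) : EReal)) := by
    refine (continuous_coe_real_ereal.tendsto _).comp ?_
    have : Continuous (fun ε : ℝ => poissonIntegral φ c r z + (1 - ε) * log (‖z - c‖ / r)) := by
      fun_prop
    simpa using (this.tendsto 0).mono_left (nhdsWithin_le_nhds (s := Ioi 0))
  refine ge_of_tendsto hlim ?_
  filter_upwards [self_mem_nhdsWithin, nhdsWithin_le_nhds (gt_mem_nhds one_pos)] with ε h1 h2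
  exact key ε h1 h2

theorem tendsto_poissonIntegral {f : ℕ → ℂ → ℝ} {φ : ℂ → ℝ} {c z : ℂ} {r C : ℝ} (hr : 0 < r)
    (hz : z ∈ ball c r) (hf : ∀ n, Continuous (f n)) (hC : ∀ n, ∀ ζ ∈ sphere c r, |f n ζ| ≤ C)
    (hlim : ∀ ζ ∈ sphere c r, Tendsto (fun n => f n ζ) atTop (𝓝 (φ ζ))) :
    Tendsto (fun n => poissonIntegral (f n) c r z) atTop (𝓝 (poissonIntegral φ c r z)) := by
  simp only [poissonIntegral, Real.circleAverage_def]
  refine Tendsto.const_smul ?_ _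
  have hmem : ∀ θ, circleMap c r θ ∈ sphere c r := circleMap_mem_sphere c hr.le
  have hk : Continuous fun θ => poissonKernel c z (circleMap c r θ) := by
    refine (continuousOn_poissonKernel hz).comp_continuous (continuous_circleMap c r) ?_
    rwa [abs_of_pos hr]
  refine intervalIntegral.tendsto_integral_filter_of_dominated_convergence
    (fun _ => (r + ‖z - c‖) / (r - ‖z - c‖) * C) ?_ ?_ ?_ ?_
  · refine .of_forall fun n => Continuous.aestronglyMeasurable ?_
    exact hk.mul ((hf n).comp (continuous_circleMap c r))
  · refine .of_forall fun n => .of_forall fun θ _ => ?_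
    rw [norm_mul, Real.norm_eq_abs, Real.norm_eq_abs,
      abs_of_nonneg (poissonKernel_nonneg hz (hmem θ))]
    have := poissonKernel_nonneg hz (hmem θ)
    exact mul_le_mul (poissonKernel_le hz (hmem θ)) (hC n _ (hmem θ)) (abs_nonneg _)
      (this.trans (poissonKernel_le hz (hmem θ)))
  · simp
  · exact .of_forall fun θ _ => (hlim _ (hmem θ)).const_mul _

theorem coe_toReal_of_le_of_le {x : EReal} {A N : ℝ} (hA : (A : EReal) ≤ x) (hN : x ≤ N) :
    (x.toReal : EReal) = x :=
  EReal.coe_toReal (hN.trans_lt (EReal.coe_lt_top N)).ne ((EReal.bot_lt_coe A).trans_le hA).ne'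

theorem UpperSemicontinuousOn.ereal_toReal {S : Set ℂ} {u : ℂ → EReal} {A N : ℝ}
    (hu : UpperSemicontinuousOn u S) (hA : ∀ z ∈ S, (A : EReal) ≤ u z) (hN : ∀ z ∈ S, u z ≤ N) :
    UpperSemicontinuousOn (fun z => (u z).toReal) S := by
  intro z hz b hb
  have h1 : u z < b := by
    rw [← coe_toReal_of_le_of_le (hA z hz) (hN z hz)]
    exact EReal.coe_lt_coe_iff.2 hb
  filter_upwards [hu z hz b h1, self_mem_nhdsWithin] with w hw hwS
  rwa [← coe_toReal_of_le_of_le (hA w hwS) (hN w hwS), EReal.coe_lt_coe_iff] at hw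

theorem UpperSemicontinuousOn.circleIntegrable {φ : ℂ → ℝ} {c : ℂ} {r A N : ℝ} (hr : 0 ≤ r)
    (hφ : UpperSemicontinuousOn φ (sphere c r)) (hA : ∀ z ∈ sphere c r, A ≤ φ z)
    (hN : ∀ z ∈ sphere c r, φ z ≤ N) : CircleIntegrable φ c r := by
  have hmem : ∀ θ, circleMap c r θ ∈ sphere c r := circleMap_mem_sphere c hr
  have hmeas : Measurable fun θ => φ (circleMap c r θ) := by
    refine UpperSemicontinuous.measurable fun θ b hb => ?_
    have h1 := hφ _ (hmem θ) b hb
    have h2 : Tendsto (circleMap c r) (𝓝 θ) (𝓝[sphere c r] circleMap c r θ) :=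
      tendsto_nhdsWithin_iff.2 ⟨(continuous_circleMap c r).tendsto θ, .of_forall hmem⟩
    exact h2.eventually h1
  rw [CircleIntegrable, intervalIntegrable_iff]
  refine Measure.integrableOn_of_bounded (M := max |A| |N|) (by simp [ENNReal.mul_eq_top])
    hmeas.aestronglyMeasurable (.of_forall fun θ => ?_)
  exact abs_le_max_abs_abs (hA _ (hmem θ)) (hN _ (hmem θ))

/-- A subharmonic function with at most a logarithmic pole at `c`, bounded on the circle, lies below
its Poisson integral plus the Green's function of the disk. -/
theorem SubharmonicOn.le_poissonIntegral_add_log {u : ℂ → EReal} {Ω : Set ℂ}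
    {c : ℂ} {r M : ℝ} (hu : SubharmonicOn u Ω) (hr : 0 < r) (hsub : closedBall c r ⊆ Ω)
    (hM : ∀ᶠ z in 𝓝[≠] c, u z ≤ ((log ‖z - c‖ + M : ℝ) : EReal))
    {A N : ℝ} (hA : ∀ ζ ∈ sphere c r, (A : EReal) ≤ u ζ) (hN : ∀ ζ ∈ sphere c r, u ζ ≤ N)
    {z : ℂ} (hz : z ∈ ball c r) (hzc : z ≠ c) :
    u z ≤ ((poissonIntegral (fun ζ => (u ζ).toReal) c r z + log (‖z - c‖ / r) : ℝ) : EReal) := by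
  have hsph : sphere c r ⊆ Ω := sphere_subset_closedBall.trans hsub
  have hco : ∀ ζ ∈ sphere c r, ((u ζ).toReal : EReal) = u ζ := fun ζ hζ =>
    coe_toReal_of_le_of_le (hA ζ hζ) (hN ζ hζ)
  have hA' : ∀ ζ ∈ sphere c r, A ≤ (u ζ).toReal := fun ζ hζ => by
    have := hA ζ hζ; rwa [← hco ζ hζ, EReal.coe_le_coe_iff] at this
  have hN' : ∀ ζ ∈ sphere c r, (u ζ).toReal ≤ N := fun ζ hζ => by
    have := hN ζ hζ; rwa [← hco ζ hζ, EReal.coe_le_coe_iff] at this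
  obtain ⟨f, hfc, hfge, hfN, hflim⟩ := exists_seq_continuous_tendsto_of_usc
    (NormedSpace.sphere_nonempty.2 hr.le) hN'
    ((hu.upperSemicontinuousOn.mono hsph).ereal_toReal hA hN)
  have hC : ∀ n, ∀ ζ ∈ sphere c r, |f n ζ| ≤ max |A| |N| := fun n ζ hζ =>
    abs_le_max_abs_abs ((hA' ζ hζ).trans (hfge n ζ hζ)) (hfN n ζ)
  have hlim := tendsto_poissonIntegral hr hz hfc hC hflim
  refine ge_of_tendsto ((continuous_coe_real_ereal.tendsto _).comp
    (hlim.add_const (log (‖z - c‖ / r)))) (.of_forall fun n => ?_)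
  refine hu.le_poissonIntegral_add_log_of_continuous hr hsub hM (hfc n) (fun ζ hζ => ?_) hz hzc
  rw [← hco ζ hζ, EReal.coe_le_coe_iff]
  exact hfge n ζ hζ

/-! ### Competitors for the Green's function -/

theorem ContinuousAt.ereal_add_coe {X : Type*} [TopologicalSpace X] {f : X → EReal} {g : X → ℝ}
    {x : X} (hf : ContinuousAt f x) (hg : ContinuousAt g x) :
    ContinuousAt (fun y => f y + (g y : EReal)) x :=
  (EReal.continuousAt_add (p := (f x, (g x : EReal))) (.inr (EReal.coe_ne_bot _))
    (.inr (EReal.coe_ne_top _))).tendsto.comp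
    (hf.prodMk_nhds (continuous_coe_real_ereal.continuousAt.comp hg))

theorem SubharmonicOn.sup {u v : ℂ → EReal} {Ω : Set ℂ} (hu : SubharmonicOn u Ω)
    (hv : SubharmonicOn v Ω) : SubharmonicOn (fun z => u z ⊔ v z) Ω where
  lt_top w hw := max_lt (hu.lt_top w hw) (hv.lt_top w hw)
  upperSemicontinuousOn := hu.upperSemicontinuousOn.sup hv.upperSemicontinuousOn
  le_circleMean w hw := by
    obtain ⟨ρ₁, h1, h1'⟩ := hu.le_circleMean w hw
    obtain ⟨ρ₂, h2, h2'⟩ := hv.le_circleMean w hw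
    refine ⟨min ρ₁ ρ₂, lt_min h1 h2, fun r hr hrρ => sup_le ?_ ?_⟩
    · exact (h1' r hr (hrρ.trans_le (min_le_left _ _))).trans
        (circleMean_mono fun z _ => le_sup_left)
    · exact (h2' r hr (hrρ.trans_le (min_le_right _ _))).trans
        (circleMean_mono fun z _ => le_sup_right)

theorem exists_forall_le_circleMean_of_harmonicAt {u : ℂ → EReal} {f : ℂ → ℝ} {w : ℂ}
    (hf : HarmonicAt f w) (hu : ∀ᶠ z in 𝓝 w, u z = f z) :
    ∃ ρ : ℝ, 0 < ρ ∧ ∀ r : ℝ, 0 < r → r < ρ → u w ≤ circleMean u w r := by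
  obtain ⟨U, hU, hUo, hwU⟩ := _root_.eventually_nhds_iff.1 (hf.eventually.and hu)
  have hharm : HarmonicOnNhd f U := fun z hz => (hU z hz).1
  obtain ⟨ρ, hρ, h⟩ := exists_forall_circleAverage_eq hUo hharm hwU
  refine ⟨ρ, hρ, fun s hs hsρ => ?_⟩
  obtain ⟨hsub, havg⟩ := h s hs hsρ
  have hsub' : sphere w s ⊆ U := sphere_subset_closedBall.trans hsub
  rw [circleMean_congr (v := fun z => (f z : EReal)) fun z hz => (hU z (hsub' (by
    rwa [abs_of_pos hs] at hz))).2, circleMean_coe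
    ((hharm.continuousOn.mono hsub').circleIntegrable hs.le), havg, hu.self_of_nhds]

/-- The function `log |z - c|` with value `-∞` at the pole `c`, where `Real.log` has the junk value
`0`. -/
noncomputable def logPole (c z : ℂ) : EReal := ENNReal.log (ENNReal.ofReal ‖z - c‖)

theorem logPole_self (c : ℂ) : logPole c c = ⊥ := by simp [logPole]

theorem logPole_of_ne {c z : ℂ} (h : z ≠ c) : logPole c z = (log ‖z - c‖ : ℝ) :=
  ENNReal.log_ofReal_of_pos (norm_pos_iff.2 (sub_ne_zero.2 h))

theorem continuous_logPole (c : ℂ) : Continuous (logPole c) :=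
  ENNReal.continuous_log.comp (ENNReal.continuous_ofReal.comp (by fun_prop))

theorem eventually_ne_of_ne {z c : ℂ} (h : z ≠ c) : ∀ᶠ w in 𝓝 z, w ≠ c :=
  isOpen_ne.mem_nhds h

theorem limsup_sub_log_lt_top {u : ℂ → EReal} {c : ℂ} {M : ℝ}
    (h : ∀ᶠ z in 𝓝[≠] c, u z ≤ ((log ‖z - c‖ + M : ℝ) : EReal)) :
    limsup (fun z : ℂ => u z - ((log ‖z - c‖ : ℝ) : EReal)) (𝓝[≠] c) < ⊤ := by
  refine lt_of_le_of_lt (limsup_le_of_le (a := (M : EReal)) (by isBoundedDefault) ?_)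
    (EReal.coe_lt_top M)
  filter_upwards [h] with z hz
  refine EReal.sub_le_of_le_add (hz.trans_eq ?_)
  rw [← EReal.coe_add, add_comm]

section Competitors

variable {Ω : Set ℂ} {c : ℂ} {u v : ℂ → EReal} {r R : ℝ}

theorem exists_eventually_le_of_mem_greenFamily (hu : u ∈ greenFamily Ω c) :
    ∃ M : ℝ, ∀ᶠ z in 𝓝[≠] c, u z ≤ ((log ‖z - c‖ + M : ℝ) : EReal) := by
  obtain ⟨M, hM, -⟩ := EReal.lt_iff_exists_real_btwn.1 hu.2.2
  refine ⟨M, ?_⟩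
  filter_upwards [eventually_lt_of_limsup_lt hM] with z hz
  have := (EReal.sub_le_iff_le_add (.inl (EReal.coe_ne_bot _)) (.inl (EReal.coe_ne_top _))).1 hz.le
  rwa [← EReal.coe_add, add_comm] at this

theorem sup_mem_greenFamily (hu : u ∈ greenFamily Ω c) (hv : v ∈ greenFamily Ω c) :
    (fun z => u z ⊔ v z) ∈ greenFamily Ω c := by
  refine ⟨hu.1.sup hv.1, fun z hz => max_lt (hu.2.1 z hz) (hv.2.1 z hz), ?_⟩
  obtain ⟨M₁, h1⟩ := exists_eventually_le_of_mem_greenFamily hu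
  obtain ⟨M₂, h2⟩ := exists_eventually_le_of_mem_greenFamily hv
  refine limsup_sub_log_lt_top (M := max M₁ M₂) ?_
  filter_upwards [h1, h2] with z hz1 hz2
  refine sup_le (hz1.trans ?_) (hz2.trans ?_) <;> rw [EReal.coe_le_coe_iff] <;> gcongr
  exacts [le_max_left _ _, le_max_right _ _]

/-- The Green's function `log (‖z - c‖ / R)` of a disk centred at `c` that contains `Ω` is a
competitor. -/
theorem logPole_sub_mem_greenFamily (hR : 0 < R) (hΩ : Ω ⊆ ball c R) :
    (fun z => logPole c z + ((-log R : ℝ) : EReal)) ∈ greenFamily Ω c := by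
  have hco : ∀ z, z ≠ c → logPole c z + ((-log R : ℝ) : EReal) = (log (‖z - c‖ / R) : ℝ) := by
    intro z hz
    rw [logPole_of_ne hz, ← EReal.coe_add, log_norm_div_eq hR hz, ← sub_eq_add_neg]
  have hcont : Continuous fun z => logPole c z + ((-log R : ℝ) : EReal) := by
    exact continuous_iff_continuousAt.2 fun z =>
      (continuous_logPole c).continuousAt.ereal_add_coe continuousAt_const
  have hneg : ∀ z ∈ Ω, logPole c z + ((-log R : ℝ) : EReal) < 0 := by
    intro z hz
    by_cases h : z = c
    · rw [h, logPole_self, EReal.bot_add]; exact EReal.bot_lt_zero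
    · rw [hco z h, ← EReal.coe_zero, EReal.coe_lt_coe_iff]
      refine log_neg (div_pos (norm_pos_iff.2 (sub_ne_zero.2 h)) hR) ?_
      rw [div_lt_one hR]
      exact mem_ball_iff_norm.1 (hΩ hz)
  refine ⟨⟨fun z hz => (hneg z hz).trans EReal.zero_lt_top,
    hcont.upperSemicontinuous.upperSemicontinuousOn _, fun w _ => ?_⟩, hneg,
    limsup_sub_log_lt_top (M := -log R) ?_⟩
  · by_cases h : w = c
    · exact ⟨1, one_pos, fun r _ _ => by rw [h, logPole_self, EReal.bot_add]; exact bot_le⟩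
    · exact exists_forall_le_circleMean_of_harmonicAt (harmonicAt_log_norm_div hR.ne' h)
        ((eventually_ne_of_ne h).mono hco)
  · filter_upwards [self_mem_nhdsWithin] with z hz
    rw [logPole_of_ne hz, ← EReal.coe_add]

open Classical in
/-- The Poisson modification of a competitor `u` with pole `c`: in the disk `ball c r` it is
`P[u] + log (‖z - c‖ / r)`, written with `logPole` so that the value at `c` is `-∞`; outside the disk
it is `u`. Taking `EReal.toReal` of the boundary values loses nothing when `u` is bounded below on
the circle. -/
noncomputable def poissonModification (u : ℂ → EReal) (c : ℂ) (r : ℝ) (z : ℂ) : EReal :=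
  if z ∈ ball c r then
    logPole c z + ((poissonIntegral (fun ζ => (u ζ).toReal) c r z - log r : ℝ) : EReal)
  else u z

theorem poissonModification_of_mem (hr : 0 < r) {z : ℂ} (hz : z ∈ ball c r) (hzc : z ≠ c) :
    poissonModification u c r z =
      ((poissonIntegral (fun ζ => (u ζ).toReal) c r z + log (‖z - c‖ / r) : ℝ) : EReal) := by
  rw [poissonModification, if_pos hz, logPole_of_ne hzc, ← EReal.coe_add, log_norm_div_eq hr hzc]
  congr 1
  ring

theorem poissonModification_of_notMem {z : ℂ} (hz : z ∉ ball c r) :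
    poissonModification u c r z = u z := if_neg hz

theorem poissonModification_center (hr : 0 < r) : poissonModification u c r c = ⊥ := by
  rw [poissonModification, if_pos (mem_ball_self hr), logPole_self, EReal.bot_add]

theorem circleIntegrable_toReal_of_mem_greenFamily (hu : u ∈ greenFamily Ω c) (hr : 0 < r)
    (hsub : closedBall c r ⊆ Ω) {A : ℝ} (hA : ∀ ζ ∈ sphere c r, (A : EReal) ≤ u ζ) :
    CircleIntegrable (fun ζ => (u ζ).toReal) c r ∧ ∀ ζ ∈ sphere c r, (u ζ).toReal ≤ 0 := by
  have hsph : sphere c r ⊆ Ω := sphere_subset_closedBall.trans hsub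
  have hN : ∀ ζ ∈ sphere c r, u ζ ≤ ((0 : ℝ) : EReal) := fun ζ hζ => (hu.2.1 ζ (hsph hζ)).le
  have hco : ∀ ζ ∈ sphere c r, ((u ζ).toReal : EReal) = u ζ := fun ζ hζ =>
    coe_toReal_of_le_of_le (hA ζ hζ) (hN ζ hζ)
  have hN' : ∀ ζ ∈ sphere c r, (u ζ).toReal ≤ 0 := fun ζ hζ => by
    have := hN ζ hζ; rwa [← hco ζ hζ, EReal.coe_le_coe_iff] at this
  refine ⟨?_, hN'⟩
  refine ((hu.1.upperSemicontinuousOn.mono hsph).ereal_toReal hA hN).circleIntegrable hr.le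
    (A := A) (fun ζ hζ => ?_) hN'
  have := hA ζ hζ; rwa [← hco ζ hζ, EReal.coe_le_coe_iff] at this

theorem le_poissonModification (hu : u ∈ greenFamily Ω c) (hr : 0 < r)
    (hsub : closedBall c r ⊆ Ω) {A : ℝ} (hA : ∀ ζ ∈ sphere c r, (A : EReal) ≤ u ζ)
    {z : ℂ} (hzc : z ≠ c) : u z ≤ poissonModification u c r z := by
  by_cases hz : z ∈ ball c r
  · obtain ⟨M, hM⟩ := exists_eventually_le_of_mem_greenFamily hu
    rw [poissonModification_of_mem hr hz hzc]
    exact hu.1.le_poissonIntegral_add_log hr hsub hM hA (N := 0)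
      (fun ζ hζ => (hu.2.1 ζ (hsub (sphere_subset_closedBall hζ))).le) hz hzc
  · rw [poissonModification_of_notMem hz]

/-- Upper semicontinuity on the circle is the boundary behaviour of Poisson integrals; the submean
inequality outside the open disk holds because the modification is at least `u`. -/
theorem poissonModification_mem_greenFamily (hu : u ∈ greenFamily Ω c) (hr : 0 < r)
    (hsub : closedBall c r ⊆ Ω) {A : ℝ} (hA : ∀ ζ ∈ sphere c r, (A : EReal) ≤ u ζ) :
    poissonModification u c r ∈ greenFamily Ω c := by
  obtain ⟨hint, hnonpos⟩ := circleIntegrable_toReal_of_mem_greenFamily hu hr hsub hA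
  set P := poissonIntegral (fun ζ => (u ζ).toReal) c r with hP
  have hPle : ∀ z ∈ ball c r, P z ≤ 0 := by
    intro z hz
    rw [← poissonIntegral_const (r := r) hz 0]
    exact poissonIntegral_mono hr.le hint (circleIntegrable_const _ _ _) hz hnonpos
  have hharm := harmonicOnNhd_poissonIntegral hint
  have hneg : ∀ z ∈ Ω, poissonModification u c r z < 0 := by
    intro z hz
    by_cases hzb : z ∈ ball c r
    · by_cases hzc : z = c
      · rw [hzc, poissonModification_center hr]; exact EReal.bot_lt_zero
      · rw [poissonModification_of_mem hr hzb hzc, ← EReal.coe_zero, EReal.coe_lt_coe_iff]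
        have : log (‖z - c‖ / r) < 0 := by
          refine log_neg (div_pos (norm_pos_iff.2 (sub_ne_zero.2 hzc)) hr) ?_
          rw [div_lt_one hr]
          exact mem_ball_iff_norm.1 hzb
        linarith [hPle z hzb]
    · rw [poissonModification_of_notMem hzb]
      exact hu.2.1 z hz
  refine ⟨⟨fun z hz => (hneg z hz).trans EReal.zero_lt_top, fun z hz => ?_, fun w hw => ?_⟩, hneg,
    limsup_sub_log_lt_top (M := -log r) ?_⟩
  · by_cases hzb : z ∈ ball c r
    · have hc : ContinuousAt (fun z => logPole c z + ((P z - log r : ℝ) : EReal)) z := by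
        refine (continuous_logPole c).continuousAt.ereal_add_coe ?_
        exact (hharm.continuousOn.continuousAt (isOpen_ball.mem_nhds hzb)).sub continuousAt_const
      have hc' : ContinuousAt (poissonModification u c r) z := by
        refine hc.congr ?_
        filter_upwards [isOpen_ball.mem_nhds hzb] with w hw
        rw [poissonModification, if_pos hw]
      exact hc'.upperSemicontinuousAt.upperSemicontinuousWithinAt _
    · intro y hy
      rw [poissonModification_of_notMem hzb] at hy
      have husc := hu.1.upperSemicontinuousOn z hz y hy
      by_cases hzs : z ∈ sphere c r
      · have hco : ∀ ζ ∈ sphere c r, ((u ζ).toReal : EReal) = u ζ := fun ζ hζ =>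
          coe_toReal_of_le_of_le (hA ζ hζ)
            (N := 0) (hu.2.1 ζ (hsub (sphere_subset_closedBall hζ))).le
        obtain ⟨b', hb', hb'y⟩ := EReal.lt_iff_exists_real_btwn.1 hy
        obtain ⟨b, hb, hbb'⟩ := EReal.lt_iff_exists_real_btwn.1 hb'
        have h1 : ∀ᶠ ζ in 𝓝[sphere c r] z, (u ζ).toReal ≤ b := by
          have := hu.1.upperSemicontinuousOn z hz b hb
          filter_upwards [nhdsWithin_mono z (sphere_subset_closedBall.trans hsub) this,
            self_mem_nhdsWithin] with ζ h1 h2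
          rw [← hco ζ h2] at h1
          exact (EReal.coe_lt_coe_iff.1 h1).le
        have h2 := eventually_poissonIntegral_lt hr hint hnonpos hzs h1
          (EReal.coe_lt_coe_iff.1 hbb')
        have hzc : z ≠ c := by
          rintro rfl
          exact hzb (mem_ball_self hr)
        filter_upwards [husc, nhdsWithin_le_nhds (eventually_nhdsWithin_iff.1 h2),
          nhdsWithin_le_nhds (eventually_ne_of_ne hzc)] with w hw1 hw2 hw3
        by_cases hwb : w ∈ ball c r
        · rw [poissonModification_of_mem hr hwb hw3]
          refine lt_trans (EReal.coe_lt_coe_iff.2 ?_) hb'y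
          have : log (‖w - c‖ / r) ≤ 0 := by
            refine log_nonpos (by positivity) ?_
            rw [div_le_one hr]
            exact (mem_ball_iff_norm.1 hwb).le
          linarith [hw2 hwb]
        · rwa [poissonModification_of_notMem hwb]
      · have hzcl : z ∈ (closedBall c r)ᶜ := by
          rw [mem_compl_iff, ← ball_union_sphere]
          exact fun h => h.elim hzb hzs
        filter_upwards [husc, nhdsWithin_le_nhds
          (isClosed_closedBall.isOpen_compl.mem_nhds hzcl)] with w hw hw2
        rwa [poissonModification_of_notMem fun h => hw2 (ball_subset_closedBall h)]
  · by_cases hwb : w ∈ ball c r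
    · by_cases hwc : w = c
      · refine ⟨1, one_pos, fun s _ _ => ?_⟩
        rw [hwc, poissonModification_center hr]
        exact bot_le
      · refine exists_forall_le_circleMean_of_harmonicAt
          ((hharm w hwb).add (harmonicAt_log_norm_div hr.ne' hwc)) ?_
        filter_upwards [isOpen_ball.mem_nhds hwb, eventually_ne_of_ne hwc] with z hz hzc
        exact poissonModification_of_mem hr hz hzc
    · rw [poissonModification_of_notMem hwb]
      obtain ⟨ρ, hρ, h⟩ := hu.1.le_circleMean w hw
      -- Radii below `r` keep the circle about `w` away from `c`, where `u` may exceed the modification.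
      refine ⟨min ρ r, lt_min hρ hr, fun s hs hsρ => ?_⟩
      refine (h s hs (hsρ.trans_le (min_le_left _ _))).trans (circleMean_mono fun z hz => ?_)
      refine le_poissonModification hu hr hsub hA ?_
      rintro rfl
      rw [abs_of_pos hs, mem_sphere'] at hz
      rw [mem_ball, not_lt] at hwb
      have := hsρ.trans_le (min_le_right _ _)
      linarith
  · filter_upwards [self_mem_nhdsWithin, nhdsWithin_le_nhds (ball_mem_nhds c hr)] with z hzc hz
    rw [poissonModification_of_mem hr hz hzc, EReal.coe_le_coe_iff, log_norm_div_eq hr hzc]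
    linarith [hPle z hz]

end Competitors

/-! ### Existence of the limit -/

section Limit

variable {Ω : Set ℂ} {c z : ℂ} {r R : ℝ}

/-- The averages over the circle `sphere c r` of the competitors that are bounded below there by
`log (r / R)`. When `Ω ⊆ ball c R`, every competitor has a majorant among these, its maximum with
`log (‖z - c‖ / R)`. -/
def competitorAverages (Ω : Set ℂ) (c : ℂ) (r R : ℝ) : Set ℝ :=
  {a | ∃ u ∈ greenFamily Ω c, (∀ ζ ∈ sphere c r, ((log (r / R) : ℝ) : EReal) ≤ u ζ) ∧
    Real.circleAverage (fun ζ => (u ζ).toReal) c r = a}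

theorem logPole_sub_eq_of_mem_sphere (hr : 0 < r) (hR : 0 < R) {ζ : ℂ} (hζ : ζ ∈ sphere c r) :
    logPole c ζ + ((-log R : ℝ) : EReal) = (log (r / R) : ℝ) := by
  have hζc : ζ ≠ c := ne_of_mem_sphere hζ hr.ne'
  rw [logPole_of_ne hζc, ← EReal.coe_add, mem_sphere_iff_norm.1 hζ, log_div hr.ne' hR.ne',
    ← sub_eq_add_neg]

theorem log_div_mem_competitorAverages (hr : 0 < r) (hR : 0 < R) (hΩ : Ω ⊆ ball c R) :
    log (r / R) ∈ competitorAverages Ω c r R := by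
  refine ⟨_, logPole_sub_mem_greenFamily hR hΩ, fun ζ hζ =>
    (logPole_sub_eq_of_mem_sphere hr hR hζ).ge, ?_⟩
  refine Real.circleAverage_const_on_circle fun ζ hζ => ?_
  rw [abs_of_pos hr] at hζ
  rw [logPole_sub_eq_of_mem_sphere hr hR hζ, EReal.toReal_coe]

theorem nonpos_of_mem_competitorAverages (hr : 0 < r) (hsub : closedBall c r ⊆ Ω) {a : ℝ}
    (ha : a ∈ competitorAverages Ω c r R) : a ≤ 0 := by
  obtain ⟨u, hu, hA, rfl⟩ := ha
  obtain ⟨hint, hnonpos⟩ := circleIntegrable_toReal_of_mem_greenFamily hu hr hsub hA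
  exact Real.circleAverage_mono_on_of_le_circle hint (by rwa [abs_of_pos hr])

theorem bddAbove_competitorAverages (hr : 0 < r) (hsub : closedBall c r ⊆ Ω) :
    BddAbove (competitorAverages Ω c r R) :=
  ⟨0, fun _ ha => nonpos_of_mem_competitorAverages hr hsub ha⟩

/-- Each competitor lies below the Poisson modification of its maximum with `log (‖z - c‖ / R)`, to
which Harnack's inequality applies. -/
theorem greenFunction_le (hr : 0 < r) (hsub : closedBall c r ⊆ Ω) (hR : 0 < R) (hΩ : Ω ⊆ ball c R)
    (hz : z ∈ ball c r) (hzc : z ≠ c) :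
    greenFunction Ω z c ≤ (((r - ‖z - c‖) / (r + ‖z - c‖) * sSup (competitorAverages Ω c r R) +
      log (‖z - c‖ / r) : ℝ) : EReal) := by
  refine iSup₂_le fun u hu => ?_
  have hv := sup_mem_greenFamily hu (logPole_sub_mem_greenFamily hR hΩ)
  set v : ℂ → EReal := fun z => u z ⊔ (logPole c z + ((-log R : ℝ) : EReal)) with hvdef
  have hA : ∀ ζ ∈ sphere c r, ((log (r / R) : ℝ) : EReal) ≤ v ζ := fun ζ hζ =>
    (logPole_sub_eq_of_mem_sphere hr hR hζ).ge.trans le_sup_right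
  obtain ⟨hint, hnonpos⟩ := circleIntegrable_toReal_of_mem_greenFamily hv hr hsub hA
  calc u z ≤ v z := le_sup_left
    _ ≤ poissonModification v c r z := le_poissonModification hv hr hsub hA hzc
    _ ≤ _ := by
      rw [poissonModification_of_mem hr hz hzc, EReal.coe_le_coe_iff]
      gcongr
      refine (poissonIntegral_le_of_nonpos hr.le hint hz hnonpos).trans ?_
      have := mem_ball_iff_norm.1 hz
      refine mul_le_mul_of_nonneg_left ?_ (div_nonneg (by linarith) (by positivity))
      exact le_csSup (bddAbove_competitorAverages hr hsub) ⟨v, hv, hA, rfl⟩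

/-- The Poisson modifications are competitors, and Harnack's inequality bounds them from below. -/
theorem le_greenFunction (hr : 0 < r) (hsub : closedBall c r ⊆ Ω) (hR : 0 < R) (hΩ : Ω ⊆ ball c R)
    (hz : z ∈ ball c r) (hzc : z ≠ c) :
    (((r + ‖z - c‖) / (r - ‖z - c‖) * sSup (competitorAverages Ω c r R) +
      log (‖z - c‖ / r) : ℝ) : EReal) ≤ greenFunction Ω z c := by
  obtain ⟨a, -, ha, hamem⟩ := exists_seq_tendsto_sSup
    ⟨_, log_div_mem_competitorAverages hr hR hΩ⟩ (bddAbove_competitorAverages (R := R) hr hsub)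
  refine le_of_tendsto' ((continuous_coe_real_ereal.tendsto _).comp
    ((ha.const_mul ((r + ‖z - c‖) / (r - ‖z - c‖))).add_const (log (‖z - c‖ / r)))) fun n => ?_
  obtain ⟨u, hu, hA, hua⟩ := hamem n
  obtain ⟨hint, hnonpos⟩ := circleIntegrable_toReal_of_mem_greenFamily hu hr hsub hA
  refine le_trans ?_ (le_iSup₂ (f := fun (u : ℂ → EReal) (_ : u ∈ greenFamily Ω c) => u z) _
    (poissonModification_mem_greenFamily hu hr hsub hA))
  rw [poissonModification_of_mem hr hz hzc]
  simp only [Function.comp_apply, EReal.coe_le_coe_iff]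
  gcongr
  rw [← hua]
  exact le_poissonIntegral_of_nonpos hr.le hint hz hnonpos

theorem tendsto_greenQuotient (hr : 0 < r) (hsub : closedBall c r ⊆ Ω) (hR : 0 < R)
    (hΩ : Ω ⊆ ball c R) :
    Tendsto (greenQuotient Ω c) (𝓝[≠] c)
      (𝓝 (ENNReal.ofReal (exp (sSup (competitorAverages Ω c r R) - log r)))) := by
  set A := sSup (competitorAverages Ω c r R) with hA
  rw [← EReal.exp_coe]
  refine (ENNReal.continuous_exp.tendsto _).comp ?_
  have hlim : ∀ g : ℂ → ℝ, ContinuousAt g c → g c = 1 →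
      Tendsto (fun z => ((g z * A - log r : ℝ) : EReal)) (𝓝[≠] c)
        (𝓝 ((A - log r : ℝ) : EReal)) := by
    intro g hg hg1
    refine (continuous_coe_real_ereal.tendsto _).comp ?_
    have : ContinuousAt (fun z => g z * A - log r) c := by fun_prop
    simpa [hg1] using this.tendsto.mono_left (nhdsWithin_le_nhds (s := {c}ᶜ))
  have h1 := hlim (fun z => (r + ‖z - c‖) / (r - ‖z - c‖))
    (by fun_prop (disch := simpa using hr.ne')) (by simp [hr.ne'])
  have h2 := hlim (fun z => (r - ‖z - c‖) / (r + ‖z - c‖))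
    (by fun_prop (disch := simpa using hr.ne')) (by simp [hr.ne'])
  have hmem : ∀ᶠ z in 𝓝[≠] c, z ∈ ball c r ∧ z ≠ c :=
    (Filter.Eventually.and (nhdsWithin_le_nhds (ball_mem_nhds c hr)) self_mem_nhdsWithin)
  refine tendsto_of_tendsto_of_tendsto_of_le_of_le' h1 h2 ?_ ?_
  · filter_upwards [hmem] with z hz
    rw [EReal.le_sub_iff_add_le (.inl (EReal.coe_ne_bot _)) (.inl (EReal.coe_ne_top _)),
      ← EReal.coe_add]
    refine le_trans (le_of_eq ?_) (le_greenFunction hr hsub hR hΩ hz.1 hz.2)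
    rw [log_norm_div_eq hr hz.2]
    congr 1
    ring
  · filter_upwards [hmem] with z hz
    rw [EReal.sub_le_iff_le_add (.inl (EReal.coe_ne_bot _)) (.inl (EReal.coe_ne_top _)),
      ← EReal.coe_add]
    refine (greenFunction_le hr hsub hR hΩ hz.1 hz.2).trans (le_of_eq ?_)
    rw [log_norm_div_eq hr hz.2]
    congr 1
    ring

theorem logCapacity_eq (hr : 0 < r) (hsub : closedBall c r ⊆ Ω) (hR : 0 < R) (hΩ : Ω ⊆ ball c R) :
    logCapacity Ω c = exp (sSup (competitorAverages Ω c r R) - log r) := by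
  rw [logCapacity, (tendsto_greenQuotient hr hsub hR hΩ).limUnder_eq,
    ENNReal.toReal_ofReal (exp_pos _).le]

end Limit

/-! ### Bounds for the capacity -/

section Strict

variable {Ω : Set ℂ} {c z : ℂ} {r R δ : ℝ}

theorem sSup_competitorAverages_le (hr : 0 < r) (hR : 0 < R) (hΩ : Ω ⊆ ball c R) {a : ℝ}
    (h : ∀ b ∈ competitorAverages Ω c r R, b ≤ a) : sSup (competitorAverages Ω c r R) ≤ a :=
  csSup_le ⟨_, log_div_mem_competitorAverages hr hR hΩ⟩ h

theorem greenFunction_le_log (hR : 0 < R) (hΩ : Ω ⊆ ball c R)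
    (hδ : ball c δ ⊆ Ω) (hz : z ∈ ball c δ) (hzc : z ≠ c) :
    greenFunction Ω z c ≤ ((log (‖z - c‖ / δ) : ℝ) : EReal) := by
  have hδ0 : 0 < δ := pos_of_mem_ball hz
  have hzpos : 0 < ‖z - c‖ := norm_pos_iff.2 (sub_ne_zero.2 hzc)
  have hlim : Tendsto (fun r : ℝ => ((log (‖z - c‖ / r) : ℝ) : EReal)) (𝓝[<] δ)
      (𝓝 ((log (‖z - c‖ / δ) : ℝ) : EReal)) := by
    refine (continuous_coe_real_ereal.tendsto _).comp ?_
    have : ContinuousAt (fun r : ℝ => log (‖z - c‖ / r)) δ :=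
      ContinuousAt.log (by fun_prop (disch := exact hδ0.ne')) (div_pos hzpos hδ0).ne'
    exact this.tendsto.mono_left nhdsWithin_le_nhds
  refine ge_of_tendsto hlim ?_
  filter_upwards [self_mem_nhdsWithin,
    nhdsWithin_le_nhds (lt_mem_nhds (mem_ball_iff_norm.1 hz))] with r hrδ hzr
  have hr : 0 < r := hzpos.trans hzr
  have hsub : closedBall c r ⊆ Ω := (closedBall_subset_ball hrδ).trans hδ
  refine (greenFunction_le hr hsub hR hΩ (mem_ball_iff_norm.2 hzr) hzc).trans ?_
  rw [EReal.coe_le_coe_iff, add_le_iff_nonpos_left]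
  refine mul_nonpos_of_nonneg_of_nonpos (div_nonneg (by linarith) (by positivity)) ?_
  exact sSup_competitorAverages_le hr hR hΩ fun b hb => nonpos_of_mem_competitorAverages hr hsub hb

/-- A nonpositive subharmonic function that is at most `-κ` on the inner circle of an annulus lies
below the harmonic function with boundary values `-κ` and `0`. -/
theorem SubharmonicOn.le_of_le_on_sphere {u : ℂ → EReal} {p : ℂ} {s S κ : ℝ} (hs : 0 < s)
    (hsS : s < S) (hu : SubharmonicOn u Ω) (hsub : closedBall p S ⊆ Ω) (hneg : ∀ z ∈ Ω, u z ≤ 0)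
    (hκ : ∀ z ∈ sphere p s, u z ≤ ((-κ : ℝ) : EReal)) (hz : z ∈ closedBall p S)
    (hz' : z ∉ ball p s) :
    u z ≤ ((κ / log (S / s) * log (‖z - p‖ / S) : ℝ) : EReal) := by
  have hS : 0 < S := hs.trans hsS
  have hlog : 0 < log (S / s) := log_pos ((one_lt_div hs).2 hsS)
  set K : Set ℂ := closedBall p S \ ball p s with hK
  set h : ℂ → ℝ := fun z => κ / log (S / s) * log (‖z - p‖ / S) with hh
  have hne : ∀ w, w ∉ ball p s → w ≠ p := by
    rintro w hw rfl
    exact hw (mem_ball_self hs)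
  set U : Set ℂ := ball p S ∩ (closedBall p s)ᶜ with hU
  have hUo : IsOpen U := isOpen_ball.inter isClosed_closedBall.isOpen_compl
  have hUK : U ⊆ K := fun w hw =>
    ⟨ball_subset_closedBall hw.1, fun h => hw.2 (ball_subset_closedBall h)⟩
  have hharm : HarmonicOnNhd h U := fun w hw =>
    (harmonicAt_log_norm_div hS.ne' (hne w (hUK hw).2)).const_smul (c := κ / log (S / s))
  refine le_of_forall_le_circleMean (K := K) (u := u) (h := h)
    ((isCompact_closedBall p S).diff isOpen_ball)
    (hu.upperSemicontinuousOn.mono (sdiff_subset.trans hsub))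
    (fun w hw => hu.lt_top w (hsub hw.1)) ?_ ?_ z ⟨hz, hz'⟩
  · refine continuousOn_const.mul (ContinuousOn.log (by fun_prop) fun w hw => ?_)
    exact div_ne_zero (norm_ne_zero_iff.2 (sub_ne_zero.2 (hne w hw.2))) hS.ne'
  · intro w hw
    by_cases hwS : w ∈ ball p S
    · by_cases hws : w ∈ closedBall p s
      · left
        have hw' : w ∈ sphere p s := by
          have := hw.2
          rw [mem_ball, not_lt] at this
          exact le_antisymm hws this
        refine (hκ w hw').trans_eq ?_
        simp only [hh]
        rw [mem_sphere_iff_norm.1 hw', ← inv_div S s, log_inv, mul_neg, div_mul_cancel₀ _ hlog.ne']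
      · right
        obtain ⟨ρ₁, hρ₁, h1⟩ := exists_forall_circleAverage_eq hUo hharm (w := w) ⟨hwS, hws⟩
        obtain ⟨ρ₂, hρ₂, h2⟩ := hu.le_circleMean w (hsub hw.1)
        obtain ⟨t, ht, ht'⟩ := exists_between (lt_min hρ₁ hρ₂)
        have h3 := h1 t ht (ht'.trans_le (min_le_left _ _))
        exact ⟨t, ht, sphere_subset_closedBall.trans (h3.1.trans hUK),
          h2 t ht (ht'.trans_le (min_le_right _ _)), h3.2.le⟩
    · left
      have hw' : w ∈ sphere p S := by
        rw [mem_ball, not_lt] at hwS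
        exact le_antisymm hw.1 hwS
      have : h w = 0 := by
        simp only [hh]
        rw [mem_sphere_iff_norm.1 hw', div_self hS.ne', log_one, mul_zero]
      rw [this]
      exact hneg w (hsub hw.1)

/-- If `Ω` contains a point `q` of the boundary of the disk `ball c δ ⊆ Ω`, then the competitors are
uniformly negative near `q`. -/
theorem exists_forall_le_neg_of_mem_sphere (hopen : IsOpen Ω) (hR : 0 < R) (hΩ : Ω ⊆ ball c R)
    (hδ0 : 0 < δ) (hδ : ball c δ ⊆ Ω) {q : ℂ} (hq : q ∈ sphere c δ) (hqΩ : q ∈ Ω) :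
    ∃ κ > 0, ∃ t > 0, ∀ u ∈ greenFamily Ω c, ∀ z ∈ ball q t, u z ≤ ((-κ : ℝ) : EReal) := by
  obtain ⟨ε, hε, hεΩ⟩ := Metric.isOpen_iff.1 hopen q hqΩ
  -- The point `p` lies on the segment from `c` to `q` at distance `s` from `q`. The circle of radius
  -- `s / 2` about `p` stays inside `ball c δ`, and the annulus `s / 2 ≤ ‖z - p‖ ≤ 2 * s` contains a
  -- neighbourhood of `q` and is contained in `Ω`.
  obtain ⟨s, hs, hs'⟩ := exists_between (lt_min (div_pos hε (by norm_num : (0 : ℝ) < 4))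
    (div_pos hδ0 (by norm_num : (0 : ℝ) < 4)))
  have hsε : s < ε / 4 := hs'.trans_le (min_le_left _ _)
  have hsδ : s < δ / 4 := hs'.trans_le (min_le_right _ _)
  have hqn : ‖q - c‖ = δ := mem_sphere_iff_norm.1 hq
  obtain ⟨p, hpq, hpc⟩ : ∃ p : ℂ, ‖p - q‖ = s ∧ ‖p - c‖ = δ - s := by
    refine ⟨c + ((1 - s / δ : ℝ) : ℂ) * (q - c), ?_, ?_⟩
    · have : c + ((1 - s / δ : ℝ) : ℂ) * (q - c) - q = ((-(s / δ) : ℝ) : ℂ) * (q - c) := by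
        push_cast; ring
      rw [this, norm_mul, hqn, Complex.norm_real, Real.norm_eq_abs, abs_neg,
        abs_of_pos (div_pos hs hδ0), div_mul_cancel₀ _ hδ0.ne']
    · have h1 : 0 < 1 - s / δ := by rw [sub_pos, div_lt_one hδ0]; linarith
      rw [add_sub_cancel_left, norm_mul, hqn, Complex.norm_real, Real.norm_eq_abs, abs_of_pos h1]
      field_simp
  have hsub : closedBall p (2 * s) ⊆ Ω := by
    intro w hw
    refine hεΩ (mem_ball_iff_norm.2 ?_)
    have h1 := mem_closedBall_iff_norm.1 hw
    have h2 := norm_sub_le_norm_sub_add_norm_sub w p q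
    linarith
  set κ := -log ((δ - s / 2) / δ) with hκ
  have hκ0 : 0 < κ := by
    rw [hκ, neg_pos]
    refine log_neg (div_pos (by linarith) hδ0) ?_
    rw [div_lt_one hδ0]
    linarith
  have hlog4 : 0 < log (2 * s / (s / 2)) := log_pos (by rw [one_lt_div (by linarith)]; linarith)
  have hlog85 : log (5 * s / 4 / (2 * s)) < 0 :=
    log_neg (by positivity) (by rw [div_lt_one (by linarith)]; linarith)
  refine ⟨-(κ / log (2 * s / (s / 2)) * log (5 * s / 4 / (2 * s))),
    neg_pos.2 (mul_neg_of_pos_of_neg (div_pos hκ0 hlog4) hlog85), s / 4, by linarith,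
    fun u hu z hz => ?_⟩
  have hzq := mem_ball_iff_norm.1 hz
  -- A point of `ball q (s / 4)` is at distance at most `s + s / 4` from `p`.
  have hzp : ‖z - p‖ ≤ 5 * s / 4 := by
    have h2 := norm_sub_le_norm_sub_add_norm_sub z q p
    rw [norm_sub_rev q p] at h2
    linarith
  have hzp' : s / 2 ≤ ‖z - p‖ := by
    have h2 := norm_sub_le_norm_sub_add_norm_sub p z q
    rw [norm_sub_rev p z] at h2
    linarith
  rw [neg_neg]
  refine (hu.1.le_of_le_on_sphere (p := p) (s := s / 2) (S := 2 * s) (κ := κ) (by linarith)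
    (by linarith) hsub (fun w hw => (hu.2.1 w hw).le) (fun w hw => ?_) ?_ ?_).trans ?_
  · have hw1 := mem_sphere_iff_norm.1 hw
    have h2 := norm_sub_le_norm_sub_add_norm_sub w p c
    have hwc : w ≠ c := by
      rintro rfl
      rw [norm_sub_rev] at hw1
      linarith
    refine (le_iSup₂ (f := fun (u : ℂ → EReal) (_ : u ∈ greenFamily Ω c) => u w) u hu).trans
      ((greenFunction_le_log hR hΩ hδ (mem_ball_iff_norm.2 (by linarith)) hwc).trans ?_)
    rw [EReal.coe_le_coe_iff, hκ, neg_neg]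
    have : 0 < ‖w - c‖ := norm_pos_iff.2 (sub_ne_zero.2 hwc)
    gcongr
    linarith
  · rw [mem_closedBall_iff_norm]; linarith
  · rw [mem_ball_iff_norm, not_lt]; exact hzp'
  · rw [EReal.coe_le_coe_iff]
    have : 0 < ‖z - p‖ := by linarith
    have := (div_pos hκ0 hlog4).le
    gcongr

/-- A nonpositive function that is at most `-κ` on `ball q t`, where `‖q - c‖ = δ`, has a negative
average over circles of radius close to `δ`, since an arc of angle `α` lies in that ball. -/
theorem circleAverage_le_of_le_neg_near {f : ℂ → ℝ} {q : ℂ} {κ t : ℝ} (hδ0 : 0 < δ)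
    (hq : q ∈ sphere c δ) (hr : 0 < r) (hf : CircleIntegrable f c r)
    (hnonpos : ∀ z ∈ sphere c r, f z ≤ 0) (hκ : ∀ z ∈ sphere c r, z ∈ ball q t → f z ≤ -κ)
    {α : ℝ} (hα0 : 0 ≤ α) (hαπ : α ≤ 2 * π) (hα : |r - δ| + δ * α < t) :
    Real.circleAverage f c r ≤ -((2 * π)⁻¹ * (α * κ)) := by
  obtain ⟨θ₀, hθ₀⟩ : q ∈ range (circleMap c δ) := by rwa [range_circleMap, abs_of_pos hδ0]
  have hmem : ∀ θ, circleMap c r θ ∈ sphere c r := circleMap_mem_sphere c hr.le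
  have hint : IntervalIntegrable (fun θ => f (circleMap c r (θ + θ₀))) volume 0 (2 * π) := by
    have hper : Function.Periodic (fun θ => f (circleMap c r θ)) (2 * π) := fun θ => by
      simp [periodic_circleMap c r θ]
    have h1 : IntervalIntegrable (fun θ => f (circleMap c r θ)) volume θ₀ (θ₀ + 2 * π) :=
      hper.intervalIntegrable₀ two_pi_pos.ne' hf _ _
    have := h1.comp_add_right θ₀
    simpa using this
  have hi1 : IntervalIntegrable (fun θ => f (circleMap c r (θ + θ₀))) volume 0 α :=
    hint.mono_set (by rw [uIcc_of_le hα0, uIcc_of_le two_pi_pos.le]; exact Icc_subset_Icc_right hαπ)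
  have hi2 : IntervalIntegrable (fun θ => f (circleMap c r (θ + θ₀))) volume α (2 * π) :=
    hint.mono_set (by rw [uIcc_of_le hαπ, uIcc_of_le two_pi_pos.le]; exact Icc_subset_Icc_left hα0)
  rw [Real.circleAverage_eq_integral_add θ₀, smul_eq_mul, ← mul_neg,
    ← intervalIntegral.integral_add_adjacent_intervals hi1 hi2]
  refine mul_le_mul_of_nonneg_left ?_ (inv_pos.2 two_pi_pos).le
  have h1 : ∫ θ in (0 : ℝ)..α, f (circleMap c r (θ + θ₀)) ≤ ∫ _ in (0 : ℝ)..α, -κ := by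
    refine intervalIntegral.integral_mono_on hα0 hi1 intervalIntegrable_const fun θ hθ => ?_
    refine hκ _ (hmem _) ?_
    rw [← hθ₀, mem_ball]
    have h2 : dist (circleMap c r (θ + θ₀)) (circleMap c δ (θ + θ₀)) = |r - δ| := by
      have : circleMap c r (θ + θ₀) - circleMap c δ (θ + θ₀)
          = ((r - δ : ℝ) : ℂ) * Complex.exp ((θ + θ₀ : ℝ) * Complex.I) := by
        simp only [circleMap]; push_cast; ring
      rw [dist_eq_norm, this, norm_mul, Complex.norm_exp_ofReal_mul_I, mul_one, Complex.norm_real,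
        Real.norm_eq_abs]
    have h3 := (lipschitzWith_circleMap c δ).dist_le_mul (θ + θ₀) θ₀
    rw [Real.dist_eq, add_sub_cancel_right, abs_of_nonneg hθ.1, Real.coe_nnabs, abs_of_pos hδ0] at h3
    have h4 := dist_triangle (circleMap c r (θ + θ₀)) (circleMap c δ (θ + θ₀)) (circleMap c δ θ₀)
    have h5 := mul_le_mul_of_nonneg_left hθ.2 hδ0.le
    linarith
  have h2 : ∫ θ in α..(2 * π), f (circleMap c r (θ + θ₀)) ≤ ∫ _ in α..(2 * π), 0 :=
    intervalIntegral.integral_mono_on hαπ hi2 intervalIntegrable_const fun θ _ => hnonpos _ (hmem _)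
  rw [intervalIntegral.integral_const] at h1 h2
  simp only [smul_eq_mul, sub_zero, mul_zero] at h1 h2
  linarith

/-- A bound on the competitor averages for all radii close to `δ` bounds the capacity, which does not
depend on the radius. -/
theorem logCapacity_le (hR : 0 < R) (hΩ : Ω ⊆ ball c R) (hδ0 : 0 < δ) (hδ : ball c δ ⊆ Ω)
    {a : ℝ} (h : ∀ᶠ r in 𝓝[<] δ, ∀ b ∈ competitorAverages Ω c r R, b ≤ a) :
    logCapacity Ω c ≤ exp (a - log δ) := by
  have hlim : Tendsto (fun r : ℝ => exp (a - log r)) (𝓝[<] δ) (𝓝 (exp (a - log δ))) := by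
    have : ContinuousAt (fun r : ℝ => exp (a - log r)) δ := by
      fun_prop (disch := exact hδ0.ne')
    exact this.tendsto.mono_left nhdsWithin_le_nhds
  refine ge_of_tendsto hlim ?_
  filter_upwards [h, self_mem_nhdsWithin, nhdsWithin_le_nhds (lt_mem_nhds hδ0)] with r hra hrδ hr
  rw [logCapacity_eq hr ((closedBall_subset_ball hrδ).trans hδ) hR hΩ]
  gcongr
  exact sSup_competitorAverages_le hr hR hΩ hra

theorem logCapacity_le_one_div (hR : 0 < R) (hΩ : Ω ⊆ ball c R) (hδ0 : 0 < δ) (hδ : ball c δ ⊆ Ω) :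
    logCapacity Ω c ≤ 1 / δ := by
  have := logCapacity_le (a := 0) hR hΩ hδ0 hδ ?_
  · rwa [zero_sub, exp_neg, exp_log hδ0, ← one_div] at this
  · filter_upwards [self_mem_nhdsWithin, nhdsWithin_le_nhds (lt_mem_nhds hδ0)] with r hrδ hr b hb
    exact nonpos_of_mem_competitorAverages hr ((closedBall_subset_ball hrδ).trans hδ) hb

theorem logCapacity_lt_one_div (hopen : IsOpen Ω) (hR : 0 < R) (hΩ : Ω ⊆ ball c R) (hδ0 : 0 < δ)
    (hδ : ball c δ ⊆ Ω) {q : ℂ} (hq : q ∈ sphere c δ) (hqΩ : q ∈ Ω) :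
    logCapacity Ω c < 1 / δ := by
  obtain ⟨κ, hκ, t, ht, hu⟩ := exists_forall_le_neg_of_mem_sphere hopen hR hΩ hδ0 hδ hq hqΩ
  set α := min (t / (2 * δ)) (2 * π) with hα
  have hα0 : 0 < α := lt_min (by positivity) two_pi_pos
  have hαt : δ * α ≤ t / 2 := by
    calc δ * α ≤ δ * (t / (2 * δ)) := by gcongr; exact min_le_left _ _
      _ = t / 2 := by field_simp
  have key := logCapacity_le (a := -((2 * π)⁻¹ * (α * κ))) hR hΩ hδ0 hδ ?_
  · refine key.trans_lt ?_
    rw [exp_sub, exp_log hδ0]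
    gcongr
    rw [exp_lt_one_iff, neg_lt_zero]
    positivity
  · filter_upwards [self_mem_nhdsWithin, nhdsWithin_le_nhds (lt_mem_nhds hδ0),
      nhdsWithin_le_nhds (lt_mem_nhds (show δ - t / 2 < δ by linarith))] with r hrδ hr hrt b hb
    obtain ⟨u, huF, hA, rfl⟩ := hb
    have hsub : closedBall c r ⊆ Ω := (closedBall_subset_ball hrδ).trans hδ
    obtain ⟨hint, hnonpos⟩ := circleIntegrable_toReal_of_mem_greenFamily huF hr hsub hA
    refine circleAverage_le_of_le_neg_near hδ0 hq hr hint hnonpos (t := t) (fun z hz hzt => ?_)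
      hα0.le (min_le_right _ _) ?_
    · have h1 := hu u huF z hzt
      rw [← coe_toReal_of_le_of_le (hA z hz) h1, EReal.coe_le_coe_iff] at h1
      exact h1
    · rw [abs_of_neg (sub_neg.2 hrδ)]
      linarith

theorem one_div_le_logCapacity (hR : 0 < R) (hΩ : Ω ⊆ ball c R) (hopen : IsOpen Ω) (hc : c ∈ Ω) :
    1 / R ≤ logCapacity Ω c := by
  obtain ⟨r, hr, hsub⟩ := nhds_basis_closedBall.mem_iff.1 (hopen.mem_nhds hc)
  have h1 := le_csSup (bddAbove_competitorAverages (R := R) hr hsub)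
    (log_div_mem_competitorAverages hr hR hΩ)
  rw [log_div hr.ne' hR.ne'] at h1
  rw [logCapacity_eq hr hsub hR hΩ, one_div, ← exp_log (inv_pos.2 hR), log_inv]
  gcongr
  linarith

end Strict

/-! ### The distance to the boundary -/

theorem ball_infDist_frontier_subset {Ω : Set ℂ} (hopen : IsOpen Ω) {z : ℂ} (hz : z ∈ Ω) :
    ball z (infDist z (frontier Ω)) ⊆ Ω := by
  by_cases hpos : 0 < infDist z (frontier Ω)
  swap
  · rw [ball_eq_empty.2 (not_lt.1 hpos)]; exact empty_subset _
  refine (convex_ball z _).isPreconnected.subset_left_of_subset_union hopen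
    isClosed_closure.isOpen_compl (disjoint_compl_right.mono_right
      (compl_subset_compl.2 subset_closure)) (fun w hw => ?_) ⟨z, mem_ball_self hpos, hz⟩
  by_contra h
  rw [mem_union, not_or, mem_compl_iff, not_not] at h
  have hwf : w ∈ frontier Ω := by rw [hopen.frontier_eq]; exact ⟨h.2, h.1⟩
  have := infDist_le_dist_of_mem (x := z) hwf
  rw [mem_ball'] at hw
  linarith

theorem mainTheorem10 (Ω : Set ℂ) (hopen : IsOpen Ω) (hconn : IsConnected Ω)
    (hbdd : Bornology.IsBounded Ω) :
    (∀ z ∈ Ω,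
      Tendsto (greenQuotient Ω z) (𝓝[≠] z) (𝓝 (ENNReal.ofReal (logCapacity Ω z))) ∧
      0 < boundaryDist Ω z ∧
      logCapacity Ω z ≤ 1 / boundaryDist Ω z) ∧
    (∀ z₀ ∈ Ω,
      logCapacity Ω z₀ = 1 / boundaryDist Ω z₀ ↔ ∃ r : ℝ, 0 < r ∧ Ω = Metric.ball z₀ r) := by
  have hfr : (frontier Ω).Nonempty := nonempty_frontier_iff.2 ⟨hconn.nonempty, fun h =>
    NormedSpace.unbounded_univ ℝ ℂ (h ▸ hbdd)⟩
  have hpos : ∀ z ∈ Ω, 0 < boundaryDist Ω z := fun z hz =>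
    (isClosed_frontier.notMem_iff_infDist_pos hfr).1 fun hzf =>
      (hopen.inter_frontier_eq.subset ⟨hz, hzf⟩ : z ∈ (∅ : Set ℂ))
  have hball : ∀ z ∈ Ω, ball z (boundaryDist Ω z) ⊆ Ω := fun z hz =>
    ball_infDist_frontier_subset hopen hz
  refine ⟨fun z hz => ?_, fun z₀ hz₀ => ⟨fun heq => ?_, ?_⟩⟩
  · obtain ⟨R, hR, hΩ⟩ := hbdd.subset_ball_lt 0 z
    obtain ⟨r, hr, hsub⟩ := nhds_basis_closedBall.mem_iff.1 (hopen.mem_nhds hz)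
    refine ⟨?_, hpos z hz, logCapacity_le_one_div hR hΩ (hpos z hz) (hball z hz)⟩
    rw [logCapacity_eq hr hsub hR hΩ]
    exact tendsto_greenQuotient hr hsub hR hΩ
  · obtain ⟨R, hR, hΩ⟩ := hbdd.subset_ball_lt 0 z₀
    refine ⟨_, hpos z₀ hz₀, (hball z₀ hz₀).antisymm' ?_⟩
    refine hconn.isPreconnected.subset_left_of_subset_union isOpen_ball
      isClosed_closedBall.isOpen_compl (disjoint_compl_right.mono_right
        (compl_subset_compl.2 ball_subset_closedBall)) (fun q hq => ?_)
      ⟨z₀, hz₀, mem_ball_self (hpos z₀ hz₀)⟩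
    by_contra h
    rw [mem_union, not_or, mem_compl_iff, not_not] at h
    have hqs : q ∈ sphere z₀ (boundaryDist Ω z₀) :=
      le_antisymm h.2 (not_lt.1 h.1)
    exact (logCapacity_lt_one_div hopen hR hΩ (hpos z₀ hz₀) (hball z₀ hz₀) hqs hq).ne heq
  · rintro ⟨r, hr, hΩ⟩
    have hδ : boundaryDist Ω z₀ = r := by
      rw [boundaryDist, hΩ, frontier_ball _ hr.ne']
      obtain ⟨p, hp⟩ := NormedSpace.sphere_nonempty (x := z₀).2 hr.le
      refine le_antisymm ((infDist_le_dist_of_mem hp).trans_eq (mem_sphere'.1 hp)) ?_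
      exact (le_infDist ⟨p, hp⟩).2 fun w hw => (mem_sphere'.1 hw).ge
    rw [hδ]
    exact le_antisymm (logCapacity_le_one_div hr hΩ.subset hr hΩ.superset)
      (one_div_le_logCapacity hr hΩ.subset hopen hz₀)
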